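/- **Setting.** Let $K,M\ge 1$ and $P>0$. The channel with $K$ users and $M$ uses is $Y(m)=\sum_{k=1}^K H_k(m)x_k(m)+N(m)$, $m=1,\dots,M$, with inputs $x_k(m)\in\mathbb C$ subject to $|x_k(m)|^2\le P$. The real and imaginary parts $H_k^r(m),H_k^i(m)$ of $H_k(m)$ have mean $0$ and variance $1$, and those of $N(m)$ have mean $0$. Let $H\in\mathbb R^{2KM}$ and $N\in\mathbb R^{2M}$ be the vectors of all real and imaginary parts of the fading and of the noise. Assume that $H=AR$ and $N=BR$ with real matrices $A\in\mathbb R^{2KM\times(2KM+2M)}$, $B\in\mathbb R^{2M\times(2KM+2M)}$ and a vector $R$ of $2KM+2M$ independent real random variables of sub-gaussian norm at most $1$, where the sub-gaussian norm of $X$ is $\inf\{t>0:\mathbb E e^{\lambda(X-\mathbb EX)}\le e^{\lambda^2t^2/2}\ \forall\lambda\in\mathbb R\}$. A matrix $A_i$ of the same size as $A$ *generates user-uncorrelated fading* if for every $m$, $j\in\{r,i\}$ and $k_1\ne k_2$ the entries of $A_iR$ at the positions of $H^j_{k_1}(m)$ and $H^j_{k_2}(m)$ are independent. Let $\mathcal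 S_1,\dots,\mathcal S_K\subseteq\mathbb R$ be closed and let $f:\mathcal S_1\times\dots\times\mathcal S_K\to\mathbb R$ be in $\mathcal F_{\mathrm{mon}}$, that is, $f(s_1,\dots,s_K)=F_0\big(\sum_k f_k(s_k)\big)$ with bounded measurable $f_k:\mathcal S_k\to\mathbb R$, a measurable $F_0:\mathcal D\to\mathbb R$ on a measurable set $\mathcal D\subseteq\mathbb R$ with $f_1(\mathcal S_1)+\dots+f_K(\mathcal S_K)\subseteq\mathcal D$, and a strictly increasing $\Phi:[0,\infty)\to[0,\infty)$ (an increment majorant) with $\Phi(0)=0$ and $|F_0(x)-F_0(y)|\le\Phi(|x-y|)$ for all $x,y\in\mathcal D$. Write $\Phi^{-1}(\varepsilon)=\inf\{t\ge0:\Phi(t)\ge\varepsilon\}$ (the usual inverse if $\varepsilon$ is a value of $\Phi$). Put $\phi_{\min,k}=\inf f_k$, $\phi_{\max,k}=\sup f_k$, $\bar\Delta(f)=\sum_k(\phi_{\max,k}-\phi_{\min,k})$ and $\Delta(f)=\max_k(\phi_{\max,k}-\phi_{\min,k})$. $\|\cdot\|$ and $\|\cdot\|_F$ are the operator and the Frobenius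 norm. **Theorem.** There is a measurable extension $G:\mathbb R\to\mathbb R$ of $F_0$, which does not depend on $M$, $P$ or the channel, such that the following scheme has the properties below. User $k$ sends $x_k(m)=\sqrt{a_k}\,U_k(m)$ with $a_k=\frac{P}{\Delta(f)}(f_k(s_k)-\phi_{\min,k})$ and i.i.d. uniform signs $U_k(m)\in\{-1,1\}$ independent of the channel; the receiver outputs $$\bar f=G\Big(\tfrac{\Delta(f)}{2MP}\big(\|Y\|^2-\mathbb E\|N\|^2\big)+\sum_{k=1}^K\phi_{\min,k}\Big)$$ (with $P/\Delta(f)$ read as $0$ if $\Delta(f)=0$). The power constraint holds, and for every $A_i$ that generates user-uncorrelated fading, with $\eta=\|(A+A_i)(A-A_i)^T\|$, for all source values $(s_1,\dots,s_K)\in\mathcal S_1\times\dots\times\mathcal S_K$ and all $\varepsilon>0$ such that $\Phi(t)\ge\varepsilon$ for some $t$, $$\mathbb P\big(|\bar f-f(s_1,\dots,s_K)|\ge\varepsilon\big)\le 2\exp\Big(-\frac{M\Phi^{-1}(\varepsilon)^2}{16F+D+4\Phi^{-1}(\varepsilon)L}\Big)+2\exp\Big(-\frac{M\Phi^{-1}(\varepsilon)^2}{256F+32\Phi^{-1}(\varepsilon)L}\Big),$$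 where a quotient with denominator $0$ is read as $0$ and $$L=\Big(\sqrt{\bar\Delta(f)}\,\|A\|+\sqrt{\tfrac{\Delta(f)}{P}}\,\|B\|\Big)^2,\qquad F=L\Big(\sqrt{\tfrac{\bar\Delta(f)}{M}}\,\|A\|_F+\sqrt{\tfrac{\Delta(f)}{PM}}\,\|B\|_F\Big)^2,$$ $$D=\Big(4\sqrt{2M}\,\bar\Delta(f)\,\eta+4\tfrac{\Delta(f)}{\sqrt{PM}}\,\|AB^T\|_F\Big)^2.$$ -/

import Mathlib

open MeasureTheory ProbabilityTheory
open scoped NNReal ENNReal Matrix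

noncomputable section

/-! ### Sub-gaussian norm and matrix norms -/

/-- The sub-gaussian norm
`inf {t > 0 | ∀ l, E exp (l (X - E X)) ≤ exp (l² t² / 2)}`, with value `∞` if there is no such `t`. -/
def subGaussianNorm {Ω : Type*} [MeasurableSpace Ω] (X : Ω → ℝ) (μ : Measure Ω) : ℝ≥0∞ :=
  ⨅ (t : ℝ≥0) (_ : 0 < t ∧ HasSubgaussianMGF (fun ω => X ω - ∫ ω', X ω' ∂μ) (t ^ 2) μ), (t : ℝ≥0∞)

/-- The operator norm of a matrix with respect to the Euclidean norms. -/
def opNorm {m n : Type*} [Fintype m] [Fintype n] [DecidableEq n] (A : Matrix m n ℝ) : ℝ :=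
  ‖LinearMap.toContinuousLinearMap (Matrix.toEuclideanLin A)‖

/-- The Frobenius norm of a matrix. -/
def frobNorm {m n : Type*} [Fintype m] [Fintype n] (A : Matrix m n ℝ) : ℝ :=
  √(∑ i, ∑ j, A i j ^ 2)

/-! ### The channel model -/

/-- Index set of the fading vector: `(m, j, k)` is the `m`-th channel use, the real (`j = 0`) or
imaginary (`j = 1`) part, and the user `k`. -/
abbrev FadingIdx (K M : ℕ) : Type := Fin M × Fin 2 × Fin K

/-- Index set of the noise vector: `(m, j)` is the `m`-th channel use and the real (`j = 0`) or
imaginary (`j = 1`) part. -/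
abbrev NoiseIdx (M : ℕ) : Type := Fin M × Fin 2

/-- Index set of the vector of independent random variables that generates fading and noise. -/
abbrev SourceIdx (K M : ℕ) : Type := Fin (2 * K * M + 2 * M)

/-- The random vector `A R`. -/
def linImage {Ω ι κ : Type*} [Fintype κ] (A : Matrix ι κ ℝ) (R : κ → Ω → ℝ) : ι → Ω → ℝ :=
  fun i ω => (A *ᵥ fun j => R j ω) i

/-- A real fading vector is user-uncorrelated: for distinct users, the real parts at the same
channel use are independent, and so are the imaginary parts. -/
def UserUncorrelated {Ω : Type*} [MeasurableSpace Ω] {K M : ℕ}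
    (h : FadingIdx K M → Ω → ℝ) (μ : Measure Ω) : Prop :=
  ∀ k₁ k₂ : Fin K, k₁ ≠ k₂ → ∀ (j : Fin 2) (m : Fin M),
    IndepFun (h (m, j, k₁)) (h (m, j, k₂)) μ

/-- The fading coefficients `H k m` and the noise `N m` follow the channel model (centered fading
with real and imaginary parts of variance one, centered noise), and they are generated as `A R`
and `B R` from a vector `R` of independent random variables of sub-gaussian norm at most one. -/
structure IsCorrelatedChannel {Ω : Type*} [MeasurableSpace Ω] {K M : ℕ} (μ : Measure Ω)
    (R : SourceIdx K M → Ω → ℝ)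
    (A : Matrix (FadingIdx K M) (SourceIdx K M) ℝ) (B : Matrix (NoiseIdx M) (SourceIdx K M) ℝ)
    (H : Fin K → Fin M → Ω → ℂ) (N : Fin M → Ω → ℂ) : Prop where
  measurable : ∀ i, Measurable (R i)
  indep : iIndepFun R μ
  norm_le : ∀ i, subGaussianNorm (R i) μ ≤ 1
  fading_re : ∀ k m ω, (H k m ω).re = linImage A R (m, 0, k) ω
  fading_im : ∀ k m ω, (H k m ω).im = linImage A R (m, 1, k) ω
  noise_re : ∀ m ω, (N m ω).re = linImage B R (m, 0) ω
  noise_im : ∀ m ω, (N m ω).im = linImage B R (m, 1) ω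
  fading_mean_re : ∀ k m, ∫ ω, (H k m ω).re ∂μ = 0
  fading_mean_im : ∀ k m, ∫ ω, (H k m ω).im ∂μ = 0
  fading_var_re : ∀ k m, variance (fun ω => (H k m ω).re) μ = 1
  fading_var_im : ∀ k m, variance (fun ω => (H k m ω).im) μ = 1
  noise_mean_re : ∀ m, ∫ ω, (N m ω).re ∂μ = 0
  noise_mean_im : ∀ m, ∫ ω, (N m ω).im ∂μ = 0

/-- The energy `∑ m, |y m|²` of a complex signal. -/
def energy {M : ℕ} (y : Fin M → ℂ) : ℝ := ∑ m, ‖y m‖ ^ 2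

/-- The expected energy of the noise. -/
def noiseEnergy {Ω : Type*} [MeasurableSpace Ω] {M : ℕ} (N : Fin M → Ω → ℂ) (μ : Measure Ω) : ℝ :=
  ∫ ω, energy (fun m => N m ω) ∂μ

/-! ### Distributed function approximation -/

/-- A scheme for distributed function approximation with `K` transmitters and `M` channel uses.
Transmitter `k` maps its source value and its own private random seed to `M` channel inputs (the
seeds are independent of each other and of the channel); the receiver maps the `M` channel outputs
to an estimate. -/
structure DFAScheme (K M : ℕ) (S : Fin K → Set ℝ) where
  Seed : Fin K → Type
  seedSpace : ∀ k, MeasurableSpace (Seed k)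
  seedLaw : ∀ k, Measure (Seed k)
  seedProb : ∀ k, IsProbabilityMeasure (seedLaw k)
  pre : ∀ k, S k → Seed k → Fin M → ℂ
  pre_measurable : ∀ k, Measurable fun p : S k × Seed k => pre k p.1 p.2
  post : (Fin M → ℂ) → ℝ
  post_measurable : Measurable post

attribute [instance] DFAScheme.seedSpace DFAScheme.seedProb

namespace DFAScheme

variable {K M : ℕ} {S : Fin K → Set ℝ}

/-- The peak power constraint `|x_k(m)|² ≤ P`. -/
def PeakPower (E : DFAScheme K M S) (P : ℝ) : Prop :=
  ∀ (k : Fin K) (s : S k) (u : E.Seed k) (m : Fin M), ‖E.pre k s u m‖ ^ 2 ≤ P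

/-- The channel output `Y(m) = ∑ k, H_k(m) x_k(m) + N(m)`. -/
def output {Ω : Type*} (E : DFAScheme K M S) (H : Fin K → Fin M → Ω → ℂ) (N : Fin M → Ω → ℂ)
    (s : ∀ k, S k) (p : Ω × (∀ k, E.Seed k)) : Fin M → ℂ :=
  fun m => ∑ k, H k m p.1 * E.pre k (s k) (p.2 k) m + N m p.1

/-- The probability, over the channel and the seeds, that the estimate of `f s` is off by at
least `ε` when the source values are `s`. -/
def errorProb {Ω : Type*} [MeasurableSpace Ω] (E : DFAScheme K M S) (μ : Measure Ω)
    (H : Fin K → Fin M → Ω → ℂ) (N : Fin M → Ω → ℂ) (f : (∀ k, S k) → ℝ)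
    (s : ∀ k, S k) (ε : ℝ) : ℝ :=
  (μ.prod (Measure.pi E.seedLaw)).real {p | ε ≤ |E.post (E.output H N s p) - f s|}

end DFAScheme

/-! ### Nomographic functions with an increment majorant -/

/-- `f (s₁, …, s_K) = F (∑ k, φ_k (s_k))` with bounded measurable inner functions, a measurable
outer function `F` on a measurable set `D`, and `Φ` an increment majorant. -/
structure IsMonRepresentation {K : ℕ} {S : Fin K → Set ℝ} (f : (∀ k, S k) → ℝ)
    (φ : ∀ k, S k → ℝ) (D : Set ℝ) (F : D → ℝ) (Φ : ℝ≥0 → ℝ≥0) : Prop where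
  inner_measurable : ∀ k, Measurable (φ k)
  inner_bounded : ∀ k, ∃ C, ∀ s, |φ k s| ≤ C
  dom_measurable : MeasurableSet D
  outer_measurable : Measurable F
  sum_mem : ∀ s : ∀ k, S k, ∑ k, φ k (s k) ∈ D
  eq_outer : ∀ s : ∀ k, S k, f s = F ⟨∑ k, φ k (s k), sum_mem s⟩
  strictMono : StrictMono Φ
  map_zero : Φ 0 = 0
  increment_le : ∀ x y : D, |F x - F y| ≤ Φ (nndist (x : ℝ) (y : ℝ))

/-- The inverse of an increment majorant, as the generalized inverse `inf {t ≥ 0 | ε ≤ Φ t}`, which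
is `t` if `ε = Φ t`. -/
def majorantInv (Φ : ℝ≥0 → ℝ≥0) (ε : ℝ) : ℝ := ((sInf {t : ℝ≥0 | ε ≤ Φ t} : ℝ≥0) : ℝ)

theorem majorantInv_apply {Φ : ℝ≥0 → ℝ≥0} (h : StrictMono Φ) (t : ℝ≥0) :
    majorantInv Φ (Φ t) = t := by
  have : {u : ℝ≥0 | ((Φ t : ℝ≥0) : ℝ) ≤ Φ u} = Set.Ici t := by
    ext u
    simp [h.le_iff_le]
  rw [majorantInv, this, csInf_Ici]

section Spread

variable {K : ℕ} {S : Fin K → Set ℝ}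

/-- The infimum of the `k`-th inner function. -/
def innerMin (φ : ∀ k, S k → ℝ) (k : Fin K) : ℝ := ⨅ s : S k, φ k s

/-- The supremum of the `k`-th inner function. -/
def innerMax (φ : ∀ k, S k → ℝ) (k : Fin K) : ℝ := ⨆ s : S k, φ k s

/-- The total spread of the inner functions. -/
def totalSpread (φ : ∀ k, S k → ℝ) : ℝ := ∑ k, (innerMax φ k - innerMin φ k)

/-- The maximal spread of the inner functions. -/
def maxSpread (φ : ∀ k, S k → ℝ) : ℝ := ⨆ k, (innerMax φ k - innerMin φ k)

end Spread

/-! ### Random-sign power encoding with energy-based estimate -/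

/-- A sign, `1` or `-1`. -/
def signOf (b : Bool) : ℝ := if b then 1 else -1

/-- Transmitter `k` sends `√a_k U_k(m)` with `a_k = (P / Δ) (φ_k(s_k) - φ_{min,k})` and independent
uniform signs `U_k(m)`. The receiver outputs `G (Δ / (2 M P) (‖Y‖² - ν) + ∑ k, φ_{min,k})`, where
`ν` is the expected noise energy and `G` is (an extension to `ℝ` of) the outer function. -/
def energyScheme {K : ℕ} (M : ℕ) {S : Fin K → Set ℝ} (φ : ∀ k, S k → ℝ)
    (hφ : ∀ k, Measurable (φ k)) (G : ℝ → ℝ) (hG : Measurable G) (P ν : ℝ) : DFAScheme K M S where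
  Seed _ := Fin M → Bool
  seedSpace _ := inferInstance
  seedLaw _ := Measure.pi fun _ => (PMF.uniformOfFintype Bool).toMeasure
  seedProb _ := inferInstance
  pre k s u m := ((√(P / maxSpread φ * (φ k s - innerMin φ k)) * signOf (u m) : ℝ) : ℂ)
  pre_measurable k := by
    have h1 : Measurable signOf := measurable_of_finite _
    have h2 := hφ k
    refine measurable_pi_lambda _ fun m => Complex.measurable_ofReal.comp ?_
    fun_prop
  post y := G (maxSpread φ / (2 * M * P) * (energy y - ν) + ∑ k, innerMin φ k)
  post_measurable := by
    unfold energy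
    fun_prop

/-! ### The constants of the error bound -/

section Constants

variable {K M : ℕ} {S : Fin K → Set ℝ}

/-- The constant `L`. -/
def constL (φ : ∀ k, S k → ℝ) (P : ℝ) (A : Matrix (FadingIdx K M) (SourceIdx K M) ℝ)
    (B : Matrix (NoiseIdx M) (SourceIdx K M) ℝ) : ℝ :=
  (√(totalSpread φ) * opNorm A + √(maxSpread φ / P) * opNorm B) ^ 2

/-- The constant `F`. -/
def constF (φ : ∀ k, S k → ℝ) (P : ℝ) (A : Matrix (FadingIdx K M) (SourceIdx K M) ℝ)
    (B : Matrix (NoiseIdx M) (SourceIdx K M) ℝ) : ℝ :=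
  constL φ P A B *
    (√(totalSpread φ / M) * frobNorm A + √(maxSpread φ / (P * M)) * frobNorm B) ^ 2

/-- The constant `η`. -/
def corrEta (A Ai : Matrix (FadingIdx K M) (SourceIdx K M) ℝ) : ℝ :=
  opNorm ((A + Ai) * (A - Ai)ᵀ)

/-- The constant `D`. -/
def constD (φ : ∀ k, S k → ℝ) (P : ℝ) (A Ai : Matrix (FadingIdx K M) (SourceIdx K M) ℝ)
    (B : Matrix (NoiseIdx M) (SourceIdx K M) ℝ) : ℝ :=
  (4 * √(2 * M) * totalSpread φ * corrEta A Ai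
    + 4 * (maxSpread φ / √(P * M)) * frobNorm (A * Bᵀ)) ^ 2

end Constants

end

/-!
The error of the estimate is controlled by the second exponential of the bound alone.

Let `y = ∑ k, φ_k (s_k)` and let `x` be the argument that the receiver passes to `G`. Outside `D`,
the extension `G` is an upper semicontinuous envelope of `F` for which an error of at least `ε` at
`x` forces `2 |x - y| ≥ Φ⁻¹(ε)` (`exists_measurable_extension`); the factor two replaces the
subadditivity that `Φ` may lack. So it suffices to bound the tail of
`2 M (x - y) = ‖T X‖² - E ‖T X‖²`, where `X` is the vector of recentered source variables and `T`,
the effective channel matrix `signalMatrix` rescaled by `√(Δ / P)`, depends on the random signs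
only. Whatever the signs, `‖T‖² ≤ L` and `‖T‖² ‖T‖_F² ≤ M F`.

The deviation has two parts, whose exponential moments multiply (`lintegral_exp_energy_le`).
* Given the signs, `‖T X‖²` deviates from its conditional expectation as in the Hanson–Wright
  inequality, proved here with explicit constants (`lintegral_exp_hansonWright_le`). The diagonal of
  the quadratic form is a sum of independent centered squares. The rest is decoupled: it is four
  times the average of its corners, over all sets of coordinates, and in each corner one group of
  variables enters linearly with coefficients depending on an independent group.
* The conditional expectation given the signs is a sum over the channel uses of independent bounded
  terms, and Hoeffding's lemma applies (`lintegral_exp_meanEnergy_le`). Its fluctuation, which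
  contains all correlations between users and between fading and noise, is already of the order of
  `F`: the ranges of the terms are bounded by `4 L` and, in sum, by twice the bound on `‖T‖_F²`.

Chernoff's bound then gives the tail (`measureReal_abs_ge_le`), with enough room in the constants to
pay for the factor two from the extension.
-/

noncomputable section

/-! ### Extension of the outer function -/

/-- An outer function with increment majorant `Φ` extends measurably to the whole line, at the cost
of doubling distances: off `D` the extension is the envelope `x ↦ inf {F y + Φ r | 2 |x - y| < r}`,
which is upper semicontinuous. Without the factor two, an extension need not exist, because `Φ` is
not assumed to be subadditive. -/
theorem exists_measurable_extension {D : Set ℝ} (hD : MeasurableSet D) {F : D → ℝ}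
    (hF : Measurable F) {Φ : ℝ≥0 → ℝ≥0} (hΦ : Monotone Φ)
    (h : ∀ x y : D, |F x - F y| ≤ Φ (nndist (x : ℝ) (y : ℝ))) :
    ∃ G : ℝ → ℝ, Measurable G ∧ (∀ x : D, G x = F x) ∧
      ∀ (x : ℝ) (y : D) (r : ℝ≥0), 2 * |x - y| < r → |G x - F y| ≤ Φ r := by
  rcases isEmpty_or_nonempty D with hDe | ⟨⟨y₀⟩⟩
  · exact ⟨0, measurable_const, fun x => hDe.elim x, fun _ y => hDe.elim y⟩
  let J : ℝ → Type := fun x => {p : D × ℝ≥0 // 2 * |x - p.1| < p.2}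
  let G₀ : ℝ → ℝ := fun x => ⨅ p : J x, (F p.1.1 + Φ p.1.2)
  have hne : ∀ x, Nonempty (J x) := fun x =>
    ⟨⟨⟨y₀, ⟨2 * |x - y₀| + 1, by positivity⟩⟩, by
      show 2 * |x - y₀| < 2 * |x - y₀| + 1
      linarith⟩⟩
  have hlow : ∀ (x : ℝ) (y : D) (r : ℝ≥0), 2 * |x - y| < r → ∀ p : J x,
      F y - Φ r ≤ F p.1.1 + Φ p.1.2 := by
    rintro x y r hr ⟨⟨d, q⟩, hq⟩
    simp only at hq ⊢
    have h1 := (abs_le.1 (h y d)).2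
    have htri : |(y : ℝ) - d| ≤ |x - y| + |x - d| := by
      rw [abs_sub_comm x y]; exact abs_sub_le _ _ _
    rcases le_total |x - y| |x - d| with h2 | h2
    · have : Φ (nndist (y : ℝ) d) ≤ Φ q := hΦ (by
        rw [← NNReal.coe_le_coe, coe_nndist, Real.dist_eq]; linarith)
      have h3 : ((Φ (nndist (y : ℝ) d) : ℝ≥0) : ℝ) ≤ Φ q := by exact_mod_cast this
      have := (Φ r).coe_nonneg
      linarith
    · have : Φ (nndist (y : ℝ) d) ≤ Φ r := hΦ (by
        rw [← NNReal.coe_le_coe, coe_nndist, Real.dist_eq]; linarith)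
      have h3 : ((Φ (nndist (y : ℝ) d) : ℝ≥0) : ℝ) ≤ Φ r := by exact_mod_cast this
      have := (Φ q).coe_nonneg
      linarith
  have hbdd : ∀ x, BddBelow (Set.range fun p : J x => F p.1.1 + (Φ p.1.2 : ℝ)) := by
    intro x
    obtain ⟨p⟩ := hne x
    refine ⟨F p.1.1 - Φ p.1.2, ?_⟩
    rintro _ ⟨q, rfl⟩
    exact hlow x p.1.1 p.1.2 p.2 q
  have hG₀ : Measurable G₀ := by
    refine measurable_of_Iio fun c => IsOpen.measurableSet ?_
    have : G₀ ⁻¹' Set.Iio c =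
        ⋃ (p : D × ℝ≥0) (_ : F p.1 + Φ p.2 < c), {x : ℝ | 2 * |x - p.1| < p.2} := by
      ext x
      have := hne x
      simp only [G₀, Set.mem_preimage, Set.mem_Iio, ciInf_lt_iff (hbdd x), Set.mem_iUnion,
        Set.mem_ofPred_eq, exists_prop]
      constructor
      · rintro ⟨⟨p, hp⟩, hc⟩
        exact ⟨p, hc, hp⟩
      · rintro ⟨p, hc, hp⟩
        exact ⟨⟨p, hp⟩, hc⟩
    rw [this]
    exact isOpen_iUnion fun p => isOpen_iUnion fun _ =>
      isOpen_lt (by fun_prop) continuous_const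
  refine ⟨Function.extend Subtype.val F G₀,
    (MeasurableEmbedding.subtype_coe hD).measurable_extend hF hG₀,
    fun x => Subtype.val_injective.extend_apply _ _ _, fun x y r hr => ?_⟩
  by_cases hx : x ∈ D
  · have : Function.extend Subtype.val F G₀ x = F ⟨x, hx⟩ :=
      Subtype.val_injective.extend_apply F G₀ ⟨x, hx⟩
    rw [this]
    refine (h _ _).trans ?_
    have : Φ (nndist x (y : ℝ)) ≤ Φ r := hΦ (by
      rw [← NNReal.coe_le_coe, coe_nndist, Real.dist_eq]
      linarith [abs_nonneg (x - y)])
    exact_mod_cast this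
  · rw [Function.extend_apply' _ _ _ (by rintro ⟨d, rfl⟩; exact hx d.2)]
    have := hne x
    have h1 : F y - Φ r ≤ G₀ x := le_ciInf (hlow x y r hr)
    have h2 : G₀ x ≤ F y + Φ r := ciInf_le (hbdd x) ⟨(y, r), hr⟩
    rw [abs_le]
    constructor <;> linarith

/-! ### Exponential moments of linear forms and of squares -/

theorem ProbabilityTheory.HasSubgaussianMGF.lintegral_exp_mul_le {Ω : Type*} [MeasurableSpace Ω]
    {μ : Measure Ω} {X : Ω → ℝ} {c : ℝ≥0} (h : HasSubgaussianMGF X c μ) (t : ℝ) :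
    ∫⁻ ω, ENNReal.ofReal (Real.exp (t * X ω)) ∂μ ≤ ENNReal.ofReal (Real.exp (c * t ^ 2 / 2)) := by
  rw [← ofReal_integral_eq_lintegral_ofReal (h.integrable_exp_mul t)
    (.of_forall fun _ => (Real.exp_pos _).le)]
  exact ENNReal.ofReal_le_ofReal (h.mgf_le t)

theorem lintegral_pi_prod {ι : Type*} [Fintype ι] (ν : ι → Measure ℝ)
    [∀ i, IsProbabilityMeasure (ν i)] {f : ι → ℝ → ℝ≥0∞} (hf : ∀ i, Measurable (f i)) :
    ∫⁻ x, ∏ i, f i (x i) ∂Measure.pi ν = ∏ i, ∫⁻ x, f i x ∂ν i := by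
  rw [lintegral_prod_eq_prod_lintegral_of_indepFun Finset.univ (fun i (x : ι → ℝ) => f i (x i))
    (iIndepFun_pi fun i => (hf i).aemeasurable) fun i => (hf i).comp (measurable_pi_apply i)]
  refine Finset.prod_congr rfl fun i _ => ?_
  exact (measurePreserving_eval ν i).lintegral_comp (hf i)

/-- A linear form in independent sub-gaussian variables is sub-gaussian. -/
theorem lintegral_exp_linear_le {ι : Type*} [Fintype ι] (ν : ι → Measure ℝ)
    [∀ i, IsProbabilityMeasure (ν i)] (hν : ∀ i, HasSubgaussianMGF (fun x => x) 1 (ν i))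
    (a : ι → ℝ) :
    ∫⁻ x, ENNReal.ofReal (Real.exp (∑ i, a i * x i)) ∂Measure.pi ν ≤
      ENNReal.ofReal (Real.exp (∑ i, a i ^ 2 / 2)) := by
  simp_rw [Real.exp_sum, ENNReal.ofReal_prod_of_nonneg fun i _ => (Real.exp_pos _).le]
  rw [lintegral_pi_prod ν (f := fun i x => ENNReal.ofReal (Real.exp (a i * x)))
    fun i => by fun_prop]
  refine Finset.prod_le_prod' fun i _ => ?_
  simpa using (hν i).lintegral_exp_mul_le (a i)

theorem lintegral_exp_mul_gaussianReal (t : ℝ) :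
    ∫⁻ x, ENNReal.ofReal (Real.exp (t * x)) ∂gaussianReal 0 1 =
      ENNReal.ofReal (Real.exp (t ^ 2 / 2)) := by
  rw [← ofReal_integral_eq_lintegral_ofReal (integrable_exp_mul_gaussianReal t)
    (.of_forall fun _ => (Real.exp_pos _).le)]
  have := congr_fun (mgf_fun_id_gaussianReal (μ := 0) (v := 1)) t
  rw [mgf] at this
  rw [this]
  simp

theorem lintegral_exp_linear_gaussianReal {ι : Type*} [Fintype ι] (a : ι → ℝ) :
    ∫⁻ x, ENNReal.ofReal (Real.exp (∑ i, a i * x i)) ∂Measure.pi (fun _ : ι => gaussianReal 0 1) =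
      ENNReal.ofReal (Real.exp (∑ i, a i ^ 2 / 2)) := by
  simp_rw [Real.exp_sum, ENNReal.ofReal_prod_of_nonneg fun i _ => (Real.exp_pos _).le]
  rw [lintegral_pi_prod _ (f := fun i x => ENNReal.ofReal (Real.exp (a i * x)))
    fun i => by fun_prop]
  exact Finset.prod_congr rfl fun i _ => lintegral_exp_mul_gaussianReal (a i)

/-- The exponential moment of the square of a standard Gaussian is `(1 - 2 θ) ^ (-1 / 2)`, which is
at most `exp (3 θ / 2)` in the stated range. -/
theorem lintegral_exp_sq_gaussianReal_le {θ : ℝ} (h0 : 0 ≤ θ) (h1 : θ ≤ 1 / 5) :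
    ∫⁻ x, ENNReal.ofReal (Real.exp (θ * x ^ 2)) ∂gaussianReal 0 1 ≤
      ENNReal.ofReal (Real.exp (3 / 2 * θ)) := by
  rw [gaussianReal_of_var_ne_zero _ one_ne_zero,
    lintegral_withDensity_eq_lintegral_mul _ (measurable_gaussianPDF _ _) (by fun_prop)]
  have hb : 0 < 1 / 2 - θ := by linarith
  have heq : ∀ x : ℝ, (gaussianPDF 0 1 * fun x => ENNReal.ofReal (Real.exp (θ * x ^ 2))) x =
      ENNReal.ofReal ((√(2 * Real.pi))⁻¹ * Real.exp (-(1 / 2 - θ) * x ^ 2)) := by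
    intro x
    rw [Pi.mul_apply, gaussianPDF, ← ENNReal.ofReal_mul (gaussianPDFReal_nonneg _ _ _),
      gaussianPDFReal, mul_assoc, ← Real.exp_add]
    congr 3
    · simp
    · simp; ring
  simp_rw [heq]
  rw [← ofReal_integral_eq_lintegral_ofReal ((integrable_exp_neg_mul_sq hb).const_mul _)
    (.of_forall fun _ => by positivity), integral_const_mul, integral_gaussian]
  apply ENNReal.ofReal_le_ofReal
  rw [← Real.sqrt_inv, ← Real.sqrt_mul (by positivity)]
  refine Real.sqrt_le_iff.2 ⟨(Real.exp_pos _).le, ?_⟩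
  have h2 : (2 * Real.pi)⁻¹ * (Real.pi / (1 / 2 - θ)) = (1 - 2 * θ)⁻¹ := by
    have : (1 - 2 * θ) ≠ 0 := by linarith
    field_simp
  rw [h2, ← Real.exp_nat_mul]
  refine inv_le_of_inv_le₀ (Real.exp_pos _) ?_
  rw [← Real.exp_neg]
  have h3 : Real.exp (-(3 * θ)) ≤ 1 - 3 * θ + (3 * θ) ^ 2 / 2 := by
    have h4 := Real.quadratic_le_exp_of_nonneg (x := 3 * θ) (by linarith)
    have h5 : 0 ≤ 1 - 3 * θ + (3 * θ) ^ 2 / 2 := by nlinarith [sq_nonneg (3 * θ - 1)]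
    rw [Real.exp_neg]
    refine inv_le_of_inv_le₀ (by nlinarith [sq_nonneg (3 * θ - 1)]) (le_trans ?_ h4)
    rw [inv_le_iff_one_le_mul₀ (by nlinarith [sq_nonneg (3 * θ - 1)])]
    nlinarith [pow_nonneg h0 4]
  have h6 : -(((2 : ℕ) : ℝ) * (3 / 2 * θ)) = -(3 * θ) := by push_cast; ring
  rw [h6]
  refine h3.trans ?_
  nlinarith

/-- Diagonalisation of the quadratic form `‖W x‖²`: it is a combination `∑ σ l ⟨v l, x⟩²` of squares
along an orthonormal basis, with `σ` bounded by the squared operator norm and summing up to the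
squared Frobenius norm. -/
theorem exists_diagonalization {ι κ : Type*} [Fintype ι] [Fintype κ] (W : Matrix κ ι ℝ) {b : ℝ}
    (hW : ∀ x : ι → ℝ, ∑ r, (W *ᵥ x) r ^ 2 ≤ b * ∑ i, x i ^ 2) :
    ∃ (σ : ι → ℝ) (V : Matrix ι ι ℝ), (∀ l, 0 ≤ σ l) ∧ (∀ l, σ l ≤ b) ∧
      ∑ l, σ l = ∑ r, ∑ i, W r i ^ 2 ∧
      (∀ x : ι → ℝ, ∑ r, (W *ᵥ x) r ^ 2 = ∑ l, σ l * (V *ᵥ x) l ^ 2) ∧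
      ∀ c : ι → ℝ, ∑ i, (c ᵥ* V) i ^ 2 = ∑ l, c l ^ 2 := by
  classical
  have hK : (Wᵀ * W).IsHermitian := by
    simpa [Matrix.conjTranspose_eq_transpose_of_trivial] using
      Matrix.isHermitian_conjTranspose_mul_self W
  have hsq : ∀ y : ι → ℝ, ∑ i, y i ^ 2 = y ⬝ᵥ y := by
    intro y; simp [dotProduct, sq]
  have hsq' : ∀ y : κ → ℝ, ∑ r, y r ^ 2 = y ⬝ᵥ y := by
    intro y; simp [dotProduct, sq]
  set U : Matrix ι ι ℝ := (hK.eigenvectorUnitary : Matrix ι ι ℝ)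
  have hUU : Uᵀ * U = 1 := by
    have := (Matrix.mem_unitaryGroup_iff').1 hK.eigenvectorUnitary.2
    simpa [Matrix.star_eq_conjTranspose, Matrix.conjTranspose_eq_transpose_of_trivial] using this
  have hspec : Wᵀ * W = U * Matrix.diagonal hK.eigenvalues * Uᵀ := by
    have := hK.spectral_theorem
    rw [Unitary.conjStarAlgAut_apply] at this
    simpa [Matrix.star_eq_conjTranspose, Matrix.conjTranspose_eq_transpose_of_trivial,
      Function.comp_def] using this
  have hquad : ∀ x : ι → ℝ, ∑ r, (W *ᵥ x) r ^ 2 = ∑ l, hK.eigenvalues l * (Uᵀ *ᵥ x) l ^ 2 := by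
    intro x
    rw [hsq', Matrix.dotProduct_mulVec, Matrix.vecMul_mulVec, ← Matrix.dotProduct_mulVec,
      congrArg (fun C => x ⬝ᵥ C *ᵥ x) hspec,
      Matrix.mul_assoc, ← Matrix.mulVec_mulVec, Matrix.dotProduct_mulVec, ← Matrix.mulVec_transpose,
      ← Matrix.mulVec_mulVec]
    simp only [dotProduct, Matrix.mulVec_diagonal]
    exact Finset.sum_congr rfl fun l _ => by ring
  have hvec : ∀ c : ι → ℝ, ∑ i, (c ᵥ* Uᵀ) i ^ 2 = ∑ l, c l ^ 2 := by
    intro c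
    rw [hsq, hsq, Matrix.vecMul_transpose, Matrix.dotProduct_mulVec, Matrix.vecMul_mulVec, hUU]
    simp
  have hval : ∀ l, hK.eigenvalues l = ∑ r, (W *ᵥ (U *ᵥ Pi.single l 1)) r ^ 2 ∧
      ∑ i, (U *ᵥ Pi.single l 1) i ^ 2 = 1 := by
    intro l
    constructor
    · rw [hquad, Matrix.mulVec_mulVec, hUU, Matrix.one_mulVec]
      simp [Pi.single_apply]
    · have := hvec (Pi.single l 1)
      rw [Matrix.vecMul_transpose] at this
      rw [this]
      simp [Pi.single_apply]
  refine ⟨hK.eigenvalues, Uᵀ, fun l => ?_, fun l => ?_, ?_, hquad, hvec⟩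
  · rw [(hval l).1]
    positivity
  · have := hW (U *ᵥ Pi.single l 1)
    rwa [← (hval l).1, (hval l).2, mul_one] at this
  · have := hK.trace_eq_sum_eigenvalues
    simp only [RCLike.ofReal_real_eq_id, id_eq] at this
    rw [← this, Matrix.trace, Finset.sum_comm]
    simp [Matrix.mul_apply, Matrix.diag, sq]

/-- Exponential moment of the squared norm of `W X`: linearise the square with the help of an
independent Gaussian vector `g`, through `exp (a² / 2) = E exp (a g)`, integrate over `X` first,
and then over `g` in the eigenbasis of `Wᵀ W`. -/
theorem lintegral_exp_sq_norm_le {ι κ : Type*} [Fintype ι] [Fintype κ] (ν : ι → Measure ℝ)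
    [∀ i, IsProbabilityMeasure (ν i)] (hν : ∀ i, HasSubgaussianMGF (fun x => x) 1 (ν i))
    (W : Matrix κ ι ℝ) {b s : ℝ} (hs : 0 ≤ s)
    (hW : ∀ x : ι → ℝ, ∑ r, (W *ᵥ x) r ^ 2 ≤ b * ∑ i, x i ^ 2) (hsb : s * b ≤ 1 / 5) :
    ∫⁻ x, ENNReal.ofReal (Real.exp (s * ∑ r, (W *ᵥ x) r ^ 2)) ∂Measure.pi ν ≤
      ENNReal.ofReal (Real.exp (3 / 2 * (s * ∑ r, ∑ i, W r i ^ 2))) := by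
  obtain ⟨σ, V, hσ0, hσb, hσs, hquad, hvec⟩ := exists_diagonalization W hW
  let γ : Measure (ι → ℝ) := Measure.pi fun _ => gaussianReal 0 1
  have h1 : ∀ x : ι → ℝ, ENNReal.ofReal (Real.exp (s * ∑ r, (W *ᵥ x) r ^ 2)) =
      ∫⁻ g, ENNReal.ofReal (Real.exp (∑ l, (√(2 * s * σ l) * (V *ᵥ x) l) * g l)) ∂γ := by
    intro x
    rw [lintegral_exp_linear_gaussianReal, hquad, Finset.mul_sum]
    congr 2
    refine Finset.sum_congr rfl fun l _ => ?_
    rw [mul_pow, Real.sq_sqrt (by have := hσ0 l; positivity)]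
    ring
  have h2 : ∀ x g : ι → ℝ, ∑ l, (√(2 * s * σ l) * (V *ᵥ x) l) * g l =
      ∑ i, ((fun l => √(2 * s * σ l) * g l) ᵥ* V) i * x i := by
    intro x g
    have := Matrix.dotProduct_mulVec (fun l => √(2 * s * σ l) * g l) V x
    simp only [dotProduct] at this
    rw [← this]
    exact Finset.sum_congr rfl fun l _ => by ring
  simp_rw [h1, h2]
  rw [lintegral_lintegral_swap (by
    refine Measurable.aemeasurable ?_
    simp only [Function.uncurry_def, Matrix.vecMul, dotProduct]
    fun_prop)]
  calc _ ≤ ∫⁻ g, ∏ l, ENNReal.ofReal (Real.exp (s * σ l * g l ^ 2)) ∂γ := by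
        refine lintegral_mono fun g => (lintegral_exp_linear_le ν hν _).trans (le_of_eq ?_)
        rw [← ENNReal.ofReal_prod_of_nonneg fun i _ => (Real.exp_pos _).le, ← Real.exp_sum,
          ← Finset.sum_div, hvec, Finset.sum_div]
        congr 2
        refine Finset.sum_congr rfl fun l _ => ?_
        rw [mul_pow, Real.sq_sqrt (by have := hσ0 l; positivity)]
        ring
    _ = ∏ l, ∫⁻ x, ENNReal.ofReal (Real.exp (s * σ l * x ^ 2)) ∂gaussianReal 0 1 :=
        lintegral_pi_prod _ (f := fun l x => ENNReal.ofReal (Real.exp (s * σ l * x ^ 2)))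
          fun i => by fun_prop
    _ ≤ ∏ l, ENNReal.ofReal (Real.exp (3 / 2 * (s * σ l))) :=
        Finset.prod_le_prod' fun l _ => lintegral_exp_sq_gaussianReal_le
          (mul_nonneg hs (hσ0 l)) ((mul_le_mul_of_nonneg_left (hσb l) hs).trans hsb)
    _ = _ := by
        rw [← ENNReal.ofReal_prod_of_nonneg fun i _ => (Real.exp_pos _).le, ← Real.exp_sum,
          ← Finset.mul_sum, ← Finset.mul_sum, hσs]

/-! ### The diagonal part of a quadratic form -/

theorem lintegral_exp_sq_le {ν : Measure ℝ} [IsProbabilityMeasure ν]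
    (hν : HasSubgaussianMGF (fun x => x) 1 ν) {θ : ℝ} (h0 : 0 ≤ θ) (h1 : θ ≤ 1 / 5) :
    ∫⁻ x, ENNReal.ofReal (Real.exp (θ * x ^ 2)) ∂ν ≤ ENNReal.ofReal (Real.exp (3 / 2 * θ)) := by
  have h2 : ∀ x : ℝ, ENNReal.ofReal (Real.exp (θ * x ^ 2)) =
      ∫⁻ g, ENNReal.ofReal (Real.exp ((√(2 * θ) * x) * g)) ∂gaussianReal 0 1 := by
    intro x
    rw [lintegral_exp_mul_gaussianReal, mul_pow, Real.sq_sqrt (by positivity)]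
    congr 2
    ring
  simp_rw [h2]
  rw [lintegral_lintegral_swap (Measurable.aemeasurable (by
    simp only [Function.uncurry_def]; fun_prop))]
  refine le_trans (lintegral_mono fun g => ?_) (lintegral_exp_sq_gaussianReal_le h0 h1)
  have := hν.lintegral_exp_mul_le (√(2 * θ) * g)
  rw [mul_pow, Real.sq_sqrt (by positivity)] at this
  convert this using 4
  · ring_nf
  · push_cast; ring

/-- Taylor remainders of the exponential scale at least quadratically. -/
theorem exp_mul_sub_le {ρ y : ℝ} (hρ : |ρ| ≤ 1) (hy : 0 ≤ y) :
    Real.exp (ρ * y) - 1 - ρ * y ≤ ρ ^ 2 * (Real.exp y - 1 - y) := by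
  let h : ℝ → ℝ := fun y => ρ ^ 2 * (Real.exp y - 1 - y) - (Real.exp (ρ * y) - 1 - ρ * y)
  have hd : ∀ y, HasDerivAt h
      (ρ ^ 2 * (Real.exp y - 1) - (Real.exp (ρ * y) * ρ - ρ)) y := by
    intro y
    have e1 := (((Real.hasDerivAt_exp y).sub_const 1).sub (hasDerivAt_id y)).const_mul (ρ ^ 2)
    have e2 : HasDerivAt (fun y => ρ * y) ρ y := by simpa using (hasDerivAt_id y).const_mul ρ
    exact e1.sub ((e2.exp.sub_const 1).sub e2)
  obtain ⟨hl, hu⟩ := abs_le.1 hρ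
  have hmono : MonotoneOn h (Set.Ici 0) := by
    refine monotoneOn_of_deriv_nonneg (convex_Ici 0)
      (fun y _ => (hd y).continuousAt.continuousWithinAt)
      (fun y _ => (hd y).differentiableAt.differentiableWithinAt) fun y hy => ?_
    rw [interior_Ici] at hy
    have hy : 0 < y := hy
    rw [(hd y).deriv]
    rcases le_total 0 ρ with h0 | h0
    · have hc := convexOn_exp.2 (Set.mem_univ 0) (Set.mem_univ y) (sub_nonneg.2 hu) h0 (by ring)
      simp only [smul_eq_mul, mul_zero, zero_add, Real.exp_zero, mul_one] at hc
      nlinarith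
    · have h1 := Real.add_one_le_exp (ρ * y)
      have h2 := Real.add_one_le_exp y
      nlinarith [mul_le_mul_of_nonneg_left h2 (sq_nonneg ρ),
        mul_le_mul_of_nonneg_left h1 (neg_nonneg.2 h0)]
  have := hmono (Set.mem_Ici.2 le_rfl) (Set.mem_Ici.2 hy) hy
  simp only [h, Real.exp_zero, mul_zero, sub_self] at this
  linarith

/-- The centered square of a sub-gaussian variable is sub-exponential. -/
theorem lintegral_exp_centered_sq_le {ν : Measure ℝ} [IsProbabilityMeasure ν]
    (hν : HasSubgaussianMGF (fun x => x) 1 ν) {l : ℝ} (hl : |l| ≤ 1 / 5) :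
    ∫⁻ x, ENNReal.ofReal (Real.exp (l * (x ^ 2 - ∫ y, y ^ 2 ∂ν))) ∂ν ≤
      ENNReal.ofReal (Real.exp (9 * l ^ 2)) := by
  set c := ∫ y, y ^ 2 ∂ν
  have hsq : Integrable (fun x : ℝ => x ^ 2) ν := (hν.memLp 2).integrable_sq
  have hle := lintegral_exp_sq_le hν (θ := 1 / 5) (by norm_num) le_rfl
  have hint : Integrable (fun x : ℝ => Real.exp (1 / 5 * x ^ 2)) ν := by
    refine ⟨(by fun_prop : Measurable _).aestronglyMeasurable, ?_⟩
    rw [hasFiniteIntegral_iff_ofReal (.of_forall fun _ => (Real.exp_pos _).le)]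
    exact hle.trans_lt ENNReal.ofReal_lt_top
  have hint5 : ∫ x, Real.exp (1 / 5 * x ^ 2) ∂ν ≤ 1.35 := by
    rw [← ofReal_integral_eq_lintegral_ofReal hint (.of_forall fun _ => (Real.exp_pos _).le),
      ENNReal.ofReal_le_ofReal_iff (Real.exp_pos _).le] at hle
    refine hle.trans ?_
    have := Real.exp_bound' (x := 3 / 2 * (1 / 5)) (by norm_num) (by norm_num) (n := 4)
      (by norm_num)
    refine this.trans ?_
    norm_num [Finset.sum_range_succ, Nat.factorial]
  have hpt : ∀ x : ℝ, Real.exp (l * x ^ 2) ≤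
      1 + l * x ^ 2 + (25 * l ^ 2) * (Real.exp (1 / 5 * x ^ 2) - 1) := by
    intro x
    have h1 := exp_mul_sub_le (ρ := 5 * l) (y := 1 / 5 * x ^ 2)
      (by rw [abs_mul]; norm_num; linarith) (by positivity)
    have h2 : 5 * l * (1 / 5 * x ^ 2) = l * x ^ 2 := by ring
    rw [h2] at h1
    nlinarith [mul_nonneg (sq_nonneg l) (sq_nonneg x)]
  have hint1 : Integrable (fun x : ℝ => 1 + l * x ^ 2) ν :=
    (integrable_const 1).add (hsq.const_mul l)
  have hint2 : Integrable (fun x : ℝ => (25 * l ^ 2) * (Real.exp (1 / 5 * x ^ 2) - 1)) ν :=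
    (hint.sub (integrable_const 1)).const_mul _
  have hintR : Integrable
      (fun x : ℝ => 1 + l * x ^ 2 + (25 * l ^ 2) * (Real.exp (1 / 5 * x ^ 2) - 1)) ν :=
    hint1.add hint2
  have hE : ∫ x, (1 + l * x ^ 2 + (25 * l ^ 2) * (Real.exp (1 / 5 * x ^ 2) - 1)) ∂ν ≤
      Real.exp (l * c + 9 * l ^ 2) := by
    rw [integral_add hint1 hint2, integral_add (integrable_const 1)
      (hsq.const_mul l), integral_const_mul, integral_const_mul,
      integral_sub hint (integrable_const 1)]
    simp only [integral_const, probReal_univ, one_smul]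
    refine le_trans ?_ (Real.add_one_le_exp _)
    nlinarith [mul_le_mul_of_nonneg_left hint5 (sq_nonneg l), sq_nonneg l]
  calc _ = ENNReal.ofReal (Real.exp (-(l * c))) *
        ∫⁻ x, ENNReal.ofReal (Real.exp (l * x ^ 2)) ∂ν := by
        rw [← lintegral_const_mul _ (by fun_prop)]
        refine lintegral_congr fun x => ?_
        rw [← ENNReal.ofReal_mul (Real.exp_pos _).le, ← Real.exp_add]
        congr 2
        ring
    _ ≤ ENNReal.ofReal (Real.exp (-(l * c))) * ENNReal.ofReal (Real.exp (l * c + 9 * l ^ 2)) := by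
        gcongr
        refine (lintegral_mono fun x => ENNReal.ofReal_le_ofReal (hpt x)).trans ?_
        rw [← ofReal_integral_eq_lintegral_ofReal hintR
          (.of_forall fun x => (Real.exp_pos _).le.trans (hpt x))]
        exact ENNReal.ofReal_le_ofReal hE
    _ = _ := by
        rw [← ENNReal.ofReal_mul (Real.exp_pos _).le, ← Real.exp_add]
        congr 2
        ring

theorem lintegral_exp_diag_le {ι : Type*} [Fintype ι] (ν : ι → Measure ℝ)
    [∀ i, IsProbabilityMeasure (ν i)] (hν : ∀ i, HasSubgaussianMGF (fun x => x) 1 (ν i))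
    (d : ι → ℝ) (hd : ∀ i, |d i| ≤ 1 / 5) :
    ∫⁻ x, ENNReal.ofReal (Real.exp (∑ i, d i * (x i ^ 2 - ∫ y, y ^ 2 ∂ν i))) ∂Measure.pi ν ≤
      ENNReal.ofReal (Real.exp (9 * ∑ i, d i ^ 2)) := by
  rw [Finset.mul_sum]
  simp_rw [Real.exp_sum, ENNReal.ofReal_prod_of_nonneg fun i _ => (Real.exp_pos _).le]
  rw [lintegral_pi_prod ν
    (f := fun i x => ENNReal.ofReal (Real.exp (d i * (x ^ 2 - ∫ y, y ^ 2 ∂ν i))))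
    fun i => by fun_prop]
  exact Finset.prod_le_prod' fun i _ => lintegral_exp_centered_sq_le (hν i) (hd i)

/-! ### The off-diagonal part of a quadratic form -/

/-- The part of a square matrix with rows in `I` and columns outside `I`. -/
def Matrix.corner {ι : Type*} [DecidableEq ι] (I : Finset ι) (G : Matrix ι ι ℝ) : Matrix ι ι ℝ :=
  Matrix.of fun i j => if i ∈ I ∧ j ∉ I then G i j else 0

/-- The bilinear form of a corner couples two disjoint, hence independent, groups of variables.
Integrating over the first group turns it into the square of a norm. -/
theorem lintegral_exp_corner_le {ι : Type*} [Fintype ι] [DecidableEq ι] (ν : ι → Measure ℝ)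
    [∀ i, IsProbabilityMeasure (ν i)] (hν : ∀ i, HasSubgaussianMGF (fun x => x) 1 (ν i))
    (I : Finset ι) (G : Matrix ι ι ℝ) (a : ℝ) :
    ∫⁻ x, ENNReal.ofReal (Real.exp (a * ∑ i, x i * (G.corner I *ᵥ x) i)) ∂Measure.pi ν ≤
      ∫⁻ x, ENNReal.ofReal (Real.exp (a ^ 2 / 2 * ∑ i, (G.corner I *ᵥ x) i ^ 2))
        ∂Measure.pi ν := by
  have hmeas : ∀ i, Measurable fun x : ι → ℝ => (G.corner I *ᵥ x) i := by
    intro i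
    simp only [Matrix.mulVec, dotProduct]
    fun_prop
  refine lintegral_le_of_lmarginal_le I (by fun_prop) (by fun_prop) fun x => ?_
  have hupd : ∀ y : (∀ _ : I, ℝ),
      G.corner I *ᵥ (Function.updateFinset x I y) = G.corner I *ᵥ x := by
    intro y
    ext i
    simp only [Matrix.mulVec, dotProduct]
    refine Finset.sum_congr rfl fun j _ => ?_
    by_cases hj : j ∈ I
    · simp [Matrix.corner, hj]
    · simp [Function.updateFinset, hj]
  have hout : ∀ i ∉ I, (G.corner I *ᵥ x) i = 0 := by
    intro i hi
    simp [Matrix.mulVec, dotProduct, Matrix.corner, hi]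
  simp only [lmarginal, hupd]
  rw [lintegral_const, measure_univ, mul_one]
  have hlin : ∀ y : (∀ _ : I, ℝ),
      a * ∑ i, Function.updateFinset x I y i * (G.corner I *ᵥ x) i =
        ∑ i : I, (a * (G.corner I *ᵥ x) i) * y i := by
    intro y
    rw [Finset.mul_sum, ← Finset.sum_subset (Finset.subset_univ I)
      (fun i _ hi => by rw [hout i hi]; ring), ← Finset.sum_coe_sort]
    refine Finset.sum_congr rfl fun i _ => ?_
    simp only [Function.updateFinset, i.2, dif_pos]
    ring
  simp_rw [hlin]
  refine (lintegral_exp_linear_le (fun i : I => ν i) (fun i => hν i) _).trans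
    (le_of_eq ?_)
  rw [Finset.sum_coe_sort I (fun i => (a * (G.corner I *ᵥ x) i) ^ 2 / 2),
    Finset.sum_subset (Finset.subset_univ I) (fun i _ hi => by rw [hout i hi]; ring),
    Finset.mul_sum]
  congr 2
  exact Finset.sum_congr rfl fun i _ => by ring

/-- For `i ≠ j`, a quarter of all sets contain `i` but not `j`. -/
theorem four_mul_card_filter_mem_notMem {ι : Type*} [Fintype ι] [DecidableEq ι] {i j : ι}
    (hij : i ≠ j) :
    4 * ((Finset.univ : Finset (Finset ι)).filter fun I => i ∈ I ∧ j ∉ I).card =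
      Fintype.card (Finset ι) := by
  have key : ((Finset.univ : Finset (Finset ι)).filter fun I => i ∈ I ∧ j ∉ I) =
      (((Finset.univ : Finset ι).erase i).erase j).powerset.image (insert i) := by
    ext I
    simp only [Finset.mem_filter, Finset.mem_univ, true_and, Finset.mem_image,
      Finset.mem_powerset]
    constructor
    · rintro ⟨hi, hj⟩
      refine ⟨I.erase i, fun k hk => ?_, Finset.insert_erase hi⟩
      simp only [Finset.mem_erase] at hk ⊢
      exact ⟨fun h => hj (h ▸ hk.2), hk.1, Finset.mem_univ _⟩
    · rintro ⟨J, hJ, rfl⟩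
      refine ⟨Finset.mem_insert_self _ _, fun h => ?_⟩
      rcases Finset.mem_insert.1 h with h | h
      · exact hij h.symm
      · simpa using hJ h
  rw [key, Finset.card_image_of_injOn, Finset.card_powerset, Finset.card_erase_of_mem,
    Finset.card_erase_of_mem (Finset.mem_univ _), Finset.card_univ, Fintype.card_finset]
  · have : 2 ≤ Fintype.card ι := by
      have := Finset.card_le_univ ({i, j} : Finset ι)
      rwa [Finset.card_pair hij] at this
    obtain ⟨n, hn⟩ := Nat.exists_eq_add_of_le this
    rw [hn, show 2 + n - 1 - 1 = n by omega, pow_add]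
    norm_num
  · simp [hij.symm]
  · intro J hJ J' hJ' h
    have h1 : i ∉ J := fun hi => by simpa using Finset.mem_powerset.1 hJ hi
    have h2 : i ∉ J' := fun hi => by simpa using Finset.mem_powerset.1 hJ' hi
    rw [← Finset.erase_insert h1, ← Finset.erase_insert h2]
    exact congrArg (fun K => K.erase i) h

/-- Decoupling: the off-diagonal part of a quadratic form is four times the average of its
corners. -/
theorem sum_corner {ι : Type*} [Fintype ι] [DecidableEq ι] (G : Matrix ι ι ℝ) (x : ι → ℝ) :
    ∑ i, ∑ j, (if i = j then 0 else G i j * x i * x j) =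
      ∑ I : Finset ι, (Fintype.card (Finset ι) : ℝ)⁻¹ *
        (4 * ∑ i, x i * (G.corner I *ᵥ x) i) := by
  have hN : (Fintype.card (Finset ι) : ℝ) ≠ 0 := by exact_mod_cast Fintype.card_ne_zero
  simp only [Matrix.mulVec, dotProduct, Finset.mul_sum]
  rw [Finset.sum_comm (s := (Finset.univ : Finset (Finset ι)))]
  refine Finset.sum_congr rfl fun i _ => ?_
  rw [Finset.sum_comm (s := (Finset.univ : Finset (Finset ι)))]
  refine Finset.sum_congr rfl fun j _ => ?_
  rcases eq_or_ne i j with rfl | hij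
  · simp [Matrix.corner]
  · have h4 := four_mul_card_filter_mem_notMem hij
    have h4' : 4 * (((Finset.univ : Finset (Finset ι)).filter
        fun I => i ∈ I ∧ j ∉ I).card : ℝ) = Fintype.card (Finset ι) := by exact_mod_cast h4
    have : ∀ I : Finset ι, (Fintype.card (Finset ι) : ℝ)⁻¹ *
        (4 * (x i * (G.corner I i j * x j))) =
        (if i ∈ I ∧ j ∉ I then 1 else 0) * ((Fintype.card (Finset ι) : ℝ)⁻¹ *
          (4 * (G i j * x i * x j))) := by
      intro I
      simp only [Matrix.corner, Matrix.of_apply]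
      split_ifs <;> ring
    rw [if_neg hij]
    simp_rw [this]
    rw [← Finset.sum_mul, Finset.sum_boole]
    field_simp
    linear_combination (-(G i j * x i * x j)) * h4'

/-- Exponential moment of the off-diagonal part of a quadratic form. -/
theorem lintegral_exp_offDiag_le {ι : Type*} [Fintype ι] [DecidableEq ι] (ν : ι → Measure ℝ)
    [∀ i, IsProbabilityMeasure (ν i)] (hν : ∀ i, HasSubgaussianMGF (fun x => x) 1 (ν i))
    (G : Matrix ι ι ℝ) {b f l : ℝ}
    (hop : ∀ x : ι → ℝ, ∑ i, (G *ᵥ x) i ^ 2 ≤ b * ∑ i, x i ^ 2)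
    (hF : ∑ i, ∑ j, G i j ^ 2 ≤ f) (hb : 0 ≤ b) (hl : 8 * l ^ 2 * b ≤ 1 / 5) :
    ∫⁻ x, ENNReal.ofReal (Real.exp (l * ∑ i, ∑ j, (if i = j then 0 else G i j * x i * x j)))
        ∂Measure.pi ν ≤
      ENNReal.ofReal (Real.exp (12 * l ^ 2 * f)) := by
  set n : ℝ := (Fintype.card (Finset ι) : ℝ)
  have hn : 0 < n := by
    simp only [n]; exact_mod_cast Fintype.card_pos
  have hw : ∑ _I : Finset ι, n⁻¹ = 1 := by
    rw [Finset.sum_const, Finset.card_univ, nsmul_eq_mul]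
    exact mul_inv_cancel₀ hn.ne'
  have hmeas : ∀ I i, Measurable fun x : ι → ℝ => (G.corner I *ᵥ x) i := by
    intro I i
    simp only [Matrix.mulVec, dotProduct]
    fun_prop
  have hcorner : ∀ I : Finset ι,
      ∫⁻ x, ENNReal.ofReal (Real.exp ((4 * l) * ∑ i, x i * (G.corner I *ᵥ x) i)) ∂Measure.pi ν ≤
        ENNReal.ofReal (Real.exp (12 * l ^ 2 * f)) := by
    intro I
    refine (lintegral_exp_corner_le ν hν I G (4 * l)).trans ?_
    have hopI : ∀ x : ι → ℝ, ∑ i, (G.corner I *ᵥ x) i ^ 2 ≤ b * ∑ i, x i ^ 2 := by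
      intro x
      have h1 : ∀ i, (G.corner I *ᵥ x) i ^ 2 ≤ (G *ᵥ fun j => if j ∉ I then x j else 0) i ^ 2 := by
        intro i
        by_cases hi : i ∈ I
        · refine le_of_eq ?_
          simp [Matrix.mulVec, dotProduct, Matrix.corner, hi]
        · simp only [Matrix.mulVec, dotProduct, Matrix.corner, hi, false_and, if_false,
            Matrix.of_apply, zero_mul, Finset.sum_const_zero, zero_pow two_ne_zero]
          positivity
      refine (Finset.sum_le_sum fun i _ => h1 i).trans ((hop _).trans ?_)
      refine mul_le_mul_of_nonneg_left (Finset.sum_le_sum fun i _ => ?_) hb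
      split_ifs <;> simp [sq_nonneg]
    have hFI : ∑ i, ∑ j, G.corner I i j ^ 2 ≤ f := by
      refine (Finset.sum_le_sum fun i _ => Finset.sum_le_sum fun j _ => ?_).trans hF
      simp only [Matrix.corner, Matrix.of_apply]
      split_ifs
      · exact le_rfl
      · simpa using sq_nonneg (G i j)
    refine (lintegral_exp_sq_norm_le ν hν (G.corner I) (by positivity) hopI ?_).trans ?_
    · linarith
    · refine ENNReal.ofReal_le_ofReal (Real.exp_le_exp.2 ?_)
      nlinarith [mul_le_mul_of_nonneg_left hFI (sq_nonneg l)]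
  calc _ ≤ ∫⁻ x, ∑ I : Finset ι, ENNReal.ofReal n⁻¹ *
        ENNReal.ofReal (Real.exp ((4 * l) * ∑ i, x i * (G.corner I *ᵥ x) i)) ∂Measure.pi ν := by
        refine lintegral_mono fun x => ?_
        simp_rw [← ENNReal.ofReal_mul (inv_nonneg.2 hn.le)]
        rw [← ENNReal.ofReal_sum_of_nonneg fun I _ => by positivity]
        refine ENNReal.ofReal_le_ofReal ?_
        have := convexOn_exp.map_sum_le (t := (Finset.univ : Finset (Finset ι)))
          (w := fun _ => n⁻¹) (p := fun I => (4 * l) * ∑ i, x i * (G.corner I *ᵥ x) i)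
          (fun _ _ => by positivity) hw (fun _ _ => Set.mem_univ _)
        simp only [smul_eq_mul] at this
        refine le_trans (le_of_eq ?_) this
        rw [sum_corner, Finset.mul_sum]
        congr 1
        exact Finset.sum_congr rfl fun I _ => by ring
    _ = ∑ I : Finset ι, ENNReal.ofReal n⁻¹ *
        ∫⁻ x, ENNReal.ofReal (Real.exp ((4 * l) * ∑ i, x i * (G.corner I *ᵥ x) i))
          ∂Measure.pi ν := by
        rw [lintegral_finsetSum _ fun I _ => by fun_prop]
        exact Finset.sum_congr rfl fun I _ => lintegral_const_mul _ (by fun_prop)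
    _ ≤ ∑ I : Finset ι, ENNReal.ofReal n⁻¹ * ENNReal.ofReal (Real.exp (12 * l ^ 2 * f)) := by
        gcongr with I
        exact hcorner I
    _ = _ := by
        rw [← Finset.sum_mul, ← ENNReal.ofReal_sum_of_nonneg fun I _ => by positivity, hw]
        simp

/-! ### A Hanson–Wright inequality -/

theorem sum_sq_transpose_mulVec_le {ι κ : Type*} [Fintype ι] [Fintype κ] (T : Matrix κ ι ℝ)
    {a : ℝ} (ha : 0 ≤ a) (hT : ∀ x : ι → ℝ, ∑ r, (T *ᵥ x) r ^ 2 ≤ a * ∑ i, x i ^ 2) (y : κ → ℝ) :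
    ∑ i, (Tᵀ *ᵥ y) i ^ 2 ≤ a * ∑ r, y r ^ 2 := by
  set N := ∑ i, (Tᵀ *ᵥ y) i ^ 2
  have hN : 0 ≤ N := Finset.sum_nonneg fun i _ => sq_nonneg _
  have h1 : N = ∑ r, y r * (T *ᵥ (Tᵀ *ᵥ y)) r := by
    have := Matrix.dotProduct_mulVec y T (Tᵀ *ᵥ y)
    rw [← Matrix.mulVec_transpose] at this
    simp only [dotProduct] at this
    rw [this]
    exact Finset.sum_congr rfl fun i _ => sq _
  have h2 : N ^ 2 ≤ (∑ r, y r ^ 2) * (a * N) := by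
    calc N ^ 2 ≤ (∑ r, y r ^ 2) * ∑ r, (T *ᵥ (Tᵀ *ᵥ y)) r ^ 2 := by
          conv_lhs => rw [h1]
          exact Finset.sum_mul_sq_le_sq_mul_sq _ _ _
      _ ≤ _ := mul_le_mul_of_nonneg_left (hT _) (Finset.sum_nonneg fun _ _ => sq_nonneg _)
  rcases hN.eq_or_lt with h0 | h0
  · rw [← h0]
    exact mul_nonneg ha (Finset.sum_nonneg fun _ _ => sq_nonneg _)
  · nlinarith

/-- Hanson–Wright inequality for the squared norm of `T X`, in terms of bounds `a` on the squared
operator norm and `f` on the squared Frobenius norm of `T`. The Gram matrix `Tᵀ T` has operator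
norm at most `a` and squared Frobenius norm at most `a f`; its diagonal part, a sum of independent
sub-exponential variables, and its off-diagonal part are separated by convexity. -/
theorem lintegral_exp_hansonWright_le {ι κ : Type*} [Fintype ι] [Fintype κ] (ν : ι → Measure ℝ)
    [∀ i, IsProbabilityMeasure (ν i)] (hν : ∀ i, HasSubgaussianMGF (fun x => x) 1 (ν i))
    (T : Matrix κ ι ℝ) {a f l : ℝ} (ha : 0 ≤ a)
    (hop : ∀ x : ι → ℝ, ∑ r, (T *ᵥ x) r ^ 2 ≤ a * ∑ i, x i ^ 2)
    (hF : ∑ r, ∑ i, T r i ^ 2 ≤ f) (hl : |l| * a ≤ 1 / 16) :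
    ∫⁻ x, ENNReal.ofReal (Real.exp (l * (∑ r, (T *ᵥ x) r ^ 2 -
        ∑ i, (∑ r, T r i ^ 2) * ∫ y, y ^ 2 ∂ν i))) ∂Measure.pi ν ≤
      ENNReal.ofReal (Real.exp (48 * l ^ 2 * (a * f))) := by
  classical
  set G : Matrix ι ι ℝ := Tᵀ * T with hG
  have hcol : ∀ j, ∑ r, T r j ^ 2 ≤ a := by
    intro j
    have := hop (Pi.single j 1)
    simpa [Pi.single_apply] using this
  have hdiag : ∀ i, G i i = ∑ r, T r i ^ 2 := by
    intro i
    simp [hG, Matrix.mul_apply, sq]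
  have hFf : ∑ i, ∑ r, T r i ^ 2 ≤ f := by rwa [Finset.sum_comm]
  have hGop : ∀ x : ι → ℝ, ∑ i, (G *ᵥ x) i ^ 2 ≤ a ^ 2 * ∑ i, x i ^ 2 := by
    intro x
    rw [hG, ← Matrix.mulVec_mulVec, sq, mul_assoc]
    exact (sum_sq_transpose_mulVec_le T ha hop _).trans (mul_le_mul_of_nonneg_left (hop x) ha)
  have hGF : ∑ i, ∑ j, G i j ^ 2 ≤ a * f := by
    rw [Finset.sum_comm]
    refine le_trans (Finset.sum_le_sum fun j _ => ?_)
      ((Finset.mul_sum _ _ _).symm.le.trans (mul_le_mul_of_nonneg_left hFf ha))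
    exact sum_sq_transpose_mulVec_le T ha hop fun r => T r j
  have hdF : ∑ i, G i i ^ 2 ≤ a * f := by
    refine le_trans (Finset.sum_le_sum fun i _ => ?_)
      ((Finset.mul_sum _ _ _).symm.le.trans (mul_le_mul_of_nonneg_left hFf ha))
    rw [hdiag, sq]
    exact mul_le_mul_of_nonneg_right (hcol i) (Finset.sum_nonneg fun _ _ => sq_nonneg _)
  have hquad : ∀ x : ι → ℝ, ∑ r, (T *ᵥ x) r ^ 2 - ∑ i, (∑ r, T r i ^ 2) * ∫ y, y ^ 2 ∂ν i =
      ∑ i, ∑ j, (if i = j then 0 else G i j * x i * x j) +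
        ∑ i, G i i * (x i ^ 2 - ∫ y, y ^ 2 ∂ν i) := by
    intro x
    have h1 : ∑ r, (T *ᵥ x) r ^ 2 = ∑ i, ∑ j, G i j * x i * x j := by
      have h2 := Matrix.dotProduct_mulVec (T *ᵥ x) T x
      rw [Matrix.vecMul_mulVec, ← Matrix.dotProduct_mulVec] at h2
      simp only [dotProduct, Matrix.mulVec, Finset.mul_sum] at h2
      simp only [Matrix.mulVec, dotProduct, sq, Finset.mul_sum]
      rw [h2]
      exact Finset.sum_congr rfl fun i _ => Finset.sum_congr rfl fun j _ => by ring
    have h3 : ∀ i, ∑ j, G i j * x i * x j =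
        ∑ j, (if i = j then 0 else G i j * x i * x j) + G i i * x i ^ 2 := by
      intro i
      have : ∀ j, G i j * x i * x j = (if i = j then 0 else G i j * x i * x j) +
          if i = j then G i i * x i ^ 2 else 0 := by
        intro j
        split_ifs with h
        · subst h; ring
        · ring
      rw [Finset.sum_congr rfl fun j _ => this j, Finset.sum_add_distrib]
      simp
    rw [h1, Finset.sum_congr rfl fun i _ => h3 i, Finset.sum_add_distrib]
    simp_rw [mul_sub, Finset.sum_sub_distrib, hdiag]
    ring
  simp_rw [hquad]
  have hl2 : l ^ 2 * a ^ 2 ≤ 1 / 256 := by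
    have := mul_self_le_mul_self (mul_nonneg (abs_nonneg l) ha) hl
    nlinarith [sq_abs l]
  have hoff := lintegral_exp_offDiag_le ν hν G (l := 2 * l) hGop hGF (sq_nonneg a)
    (by nlinarith)
  have hdg := lintegral_exp_diag_le ν hν (fun i => 2 * l * G i i) (fun i => by
    rw [abs_mul, abs_mul, abs_two, hdiag,
      abs_of_nonneg (a := ∑ r, T r i ^ 2) (Finset.sum_nonneg fun _ _ => sq_nonneg _)]
    nlinarith [mul_le_mul_of_nonneg_left (hcol i) (abs_nonneg l)])
  have hconv : ∀ p q : ℝ, ENNReal.ofReal (Real.exp (l * (p + q))) ≤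
      ENNReal.ofReal (1 / 2) * ENNReal.ofReal (Real.exp (2 * l * p)) +
        ENNReal.ofReal (1 / 2) * ENNReal.ofReal (Real.exp (2 * l * q)) := by
    intro p q
    rw [← ENNReal.ofReal_mul (by norm_num), ← ENNReal.ofReal_mul (by norm_num),
      ← ENNReal.ofReal_add (by positivity) (by positivity)]
    refine ENNReal.ofReal_le_ofReal ?_
    have := convexOn_exp.2 (Set.mem_univ (2 * l * p)) (Set.mem_univ (2 * l * q))
      (by norm_num : (0 : ℝ) ≤ 1 / 2) (by norm_num : (0 : ℝ) ≤ 1 / 2) (by norm_num)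
    simp only [smul_eq_mul] at this
    refine le_trans (le_of_eq ?_) this
    congr 1
    ring
  have haf : 0 ≤ a * f :=
    mul_nonneg ha (le_trans (Finset.sum_nonneg fun _ _ => Finset.sum_nonneg fun _ _ => sq_nonneg _) hF)
  calc _ ≤ ∫⁻ x, (ENNReal.ofReal (1 / 2) * ENNReal.ofReal (Real.exp (2 * l *
          ∑ i, ∑ j, (if i = j then 0 else G i j * x i * x j))) +
        ENNReal.ofReal (1 / 2) * ENNReal.ofReal (Real.exp (2 * l *
          ∑ i, G i i * (x i ^ 2 - ∫ y, y ^ 2 ∂ν i)))) ∂Measure.pi ν :=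
        lintegral_mono fun x => hconv _ _
    _ = ENNReal.ofReal (1 / 2) * ∫⁻ x, ENNReal.ofReal (Real.exp (2 * l *
          ∑ i, ∑ j, (if i = j then 0 else G i j * x i * x j))) ∂Measure.pi ν +
        ENNReal.ofReal (1 / 2) * ∫⁻ x, ENNReal.ofReal (Real.exp (
          ∑ i, 2 * l * G i i * (x i ^ 2 - ∫ y, y ^ 2 ∂ν i))) ∂Measure.pi ν := by
        have hm : Measurable fun x : ι → ℝ => ENNReal.ofReal (Real.exp (2 * l *
          ∑ i, ∑ j, (if i = j then 0 else G i j * x i * x j))) := by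
          have : ∀ i j, Measurable fun x : ι → ℝ => if i = j then 0 else G i j * x i * x j := by
            intro i j
            split_ifs <;> fun_prop
          fun_prop
        rw [lintegral_add_left (hm.const_mul _), lintegral_const_mul _ hm,
          lintegral_const_mul _ (by fun_prop)]
        simp_rw [Finset.mul_sum, mul_assoc]
    _ ≤ ENNReal.ofReal (1 / 2) * ENNReal.ofReal (Real.exp (48 * l ^ 2 * (a * f))) +
        ENNReal.ofReal (1 / 2) * ENNReal.ofReal (Real.exp (48 * l ^ 2 * (a * f))) := by
        gcongr
        · refine hoff.trans (ENNReal.ofReal_le_ofReal (Real.exp_le_exp.2 (le_of_eq ?_)))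
          ring
        · refine hdg.trans (ENNReal.ofReal_le_ofReal (Real.exp_le_exp.2 ?_))
          simp_rw [mul_pow]
          rw [← Finset.mul_sum]
          nlinarith [mul_le_mul_of_nonneg_left hdF (sq_nonneg l), mul_nonneg (sq_nonneg l) haf]
    _ = _ := by
        rw [← add_mul, ← ENNReal.ofReal_add (by norm_num) (by norm_num)]
        norm_num

/-! ### Second moments -/

/-- Second moment of a shifted sum of independent centered variables. -/
theorem integral_sq_sum_pi {κ : Type*} [Fintype κ] {α : κ → Type*} [∀ k, MeasurableSpace (α k)]
    (P : ∀ k, Measure (α k)) [∀ k, IsProbabilityMeasure (P k)] {Z : ∀ k, α k → ℝ}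
    (hZ : ∀ k, MemLp (Z k) 2 (P k)) (hmean : ∀ k, ∫ b, Z k b ∂P k = 0) (d : ℝ) :
    ∫ v, (∑ k, Z k (v k) + d) ^ 2 ∂Measure.pi P = ∑ k, ∫ b, Z k b ^ 2 ∂P k + d ^ 2 := by
  have hvar := variance_sum_pi hZ
  have hL : ∀ k, MemLp (fun v : ∀ k, α k => Z k (v k)) 2 (Measure.pi P) := fun k =>
    (hZ k).comp_measurePreserving (measurePreserving_eval P k)
  have hLs : MemLp (∑ k, fun v : ∀ k, α k => Z k (v k)) 2 (Measure.pi P) :=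
    memLp_finsetSum' _ fun k _ => hL k
  have hsum : ∫ v, (∑ k, fun v : ∀ k, α k => Z k (v k)) v ∂Measure.pi P = 0 := by
    simp only [Finset.sum_apply]
    rw [integral_finsetSum _ fun k _ => (hL k).integrable one_le_two]
    refine Finset.sum_eq_zero fun k _ => ?_
    rw [← hmean k]
    exact (measurePreserving_eval P k).hasLaw.integral_comp (hZ k).aestronglyMeasurable
  rw [variance_of_integral_eq_zero hLs.aestronglyMeasurable.aemeasurable hsum] at hvar
  have hvark : ∀ k, Var[Z k; P k] = ∫ b, Z k b ^ 2 ∂P k := fun k =>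
    variance_of_integral_eq_zero (hZ k).aestronglyMeasurable.aemeasurable (hmean k)
  simp_rw [hvark] at hvar
  rw [← hvar]
  have : ∀ v : ∀ k, α k, (∑ k, Z k (v k) + d) ^ 2 =
      (((∑ k, fun v : ∀ k, α k => Z k (v k)) v) ^ 2 +
        2 * d * ((∑ k, fun v : ∀ k, α k => Z k (v k)) v)) + d ^ 2 := by
    intro v
    simp only [Finset.sum_apply]
    ring
  simp_rw [this]
  have i1 := hLs.integrable_sq
  have i2 := (hLs.integrable one_le_two).const_mul (2 * d)
  have i12 : Integrable (fun v => ((∑ k, fun v : ∀ k, α k => Z k (v k)) v) ^ 2 +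
      2 * d * ((∑ k, fun v : ∀ k, α k => Z k (v k)) v)) (Measure.pi P) := i1.add i2
  rw [integral_add i12 (integrable_const _), integral_add i1 i2, integral_const_mul, hsum]
  simp

theorem ProbabilityTheory.HasSubgaussianMGF.integral_sq_le_two {ν : Measure ℝ}
    [IsProbabilityMeasure ν] (hν : HasSubgaussianMGF (fun x => x) 1 ν) : ∫ y, y ^ 2 ∂ν ≤ 2 := by
  have h1 := hν.integrable_exp_mul 1
  have h2 := hν.integrable_exp_mul (-1)
  have b1 := hν.mgf_le 1
  have b2 := hν.mgf_le (-1)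
  rw [mgf] at b1 b2
  have hle : ∫ y, y ^ 2 ∂ν ≤ ∫ y, (Real.exp (1 * y) + Real.exp (-1 * y) - 2) ∂ν := by
    refine integral_mono (hν.memLp 2).integrable_sq ((h1.add h2).sub (integrable_const 2))
      fun y => ?_
    have hs : |y / 2| ≤ |Real.sinh (y / 2)| := by
      rw [Real.abs_sinh]
      exact Real.self_le_sinh_iff.2 (abs_nonneg _)
    have hc := Real.cosh_two_mul (y / 2)
    rw [Real.cosh_sq, show 2 * (y / 2) = y by ring, Real.cosh_eq] at hc
    simp only [one_mul, neg_one_mul]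
    linarith [sq_le_sq.2 hs]
  have h12 : Integrable (fun y => Real.exp (1 * y) + Real.exp (-1 * y)) ν := h1.add h2
  rw [integral_sub h12 (integrable_const 2), integral_add h1 h2] at hle
  simp only [integral_const, probReal_univ, one_smul] at hle
  have he : Real.exp (1 / 2) ≤ 2 := by
    have := Real.exp_bound' (x := 1 / 2) (by norm_num) (by norm_num) (n := 3) (by norm_num)
    refine this.trans ?_
    norm_num [Finset.sum_range_succ, Nat.factorial]
  norm_num at b1 b2
  norm_num at he hle
  linarith

/-! ### Random signs -/

/-- The uniform distribution on `Bool`. -/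
abbrev fairBool : Measure Bool := (PMF.uniformOfFintype Bool).toMeasure

theorem measurable_signOf : Measurable signOf := measurable_of_finite _

theorem integral_signOf (h : ℝ → ℝ) : ∫ b, h (signOf b) ∂fairBool = (h 1 + h (-1)) / 2 := by
  rw [PMF.integral_eq_sum]
  simp [signOf, PMF.uniformOfFintype_apply]
  ring

/-- Transposing an array of independent fair bits. -/
theorem measurePreserving_swap_fairBool (κ₁ κ₂ : Type*) [Fintype κ₁] [Fintype κ₂] :
    MeasurePreserving (fun (u : κ₁ → κ₂ → Bool) m k => u k m)
      (Measure.pi fun _ => Measure.pi fun _ => fairBool)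
      (Measure.pi fun _ => Measure.pi fun _ => fairBool) := by
  have hm : Measurable (fun (u : κ₁ → κ₂ → Bool) m k => u k m) := by fun_prop
  refine ⟨hm, Measure.ext_of_singleton fun v => ?_⟩
  rw [Measure.map_apply hm (measurableSet_singleton v)]
  have : (fun (u : κ₁ → κ₂ → Bool) m k => u k m) ⁻¹' {v} = {fun k m => v m k} := by
    ext u
    simp only [Set.mem_preimage, Set.mem_singleton_iff, funext_iff]
    exact forall_comm
  rw [this]
  simp only [Measure.pi_singleton]
  exact Finset.prod_comm

theorem integral_sq_sum_signOf {κ : Type*} [Fintype κ] (a : κ → ℝ) (d : ℝ) :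
    ∫ v : κ → Bool, (∑ k, signOf (v k) * a k + d) ^ 2 ∂Measure.pi (fun _ => fairBool) =
      ∑ k, a k ^ 2 + d ^ 2 := by
  rw [integral_sq_sum_pi (fun _ : κ => fairBool) (Z := fun k b => signOf b * a k)
    (fun k => .of_discrete) fun k => by rw [integral_signOf fun x => x * a k]; ring]
  congr 1
  refine Finset.sum_congr rfl fun k _ => ?_
  rw [integral_signOf fun x => (x * a k) ^ 2]
  ring

/-! ### The effective channel matrix and its norms -/

section SignalMatrix

variable {K M : ℕ} {ι : Type*}

/-- The received signal at channel use `m`, part `j`, as a linear form in the underlying independent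
variables, when user `k` sends `β k` times its sign and the noise is scaled by `c`. -/
def signalRow (β : Fin K → ℝ) (c : ℝ) (A : Matrix (FadingIdx K M) ι ℝ)
    (B : Matrix (NoiseIdx M) ι ℝ) (m : Fin M) (v : Fin K → Bool) (j : Fin 2) (i : ι) : ℝ :=
  ∑ k, signOf (v k) * (β k * A (m, j, k) i) + c * B (m, j) i

/-- The matrix with rows `signalRow`: the received signal is its product with the vector of
independent variables. The array `e` lists the signs by channel use first. -/
def signalMatrix (β : Fin K → ℝ) (c : ℝ) (A : Matrix (FadingIdx K M) ι ℝ)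
    (B : Matrix (NoiseIdx M) ι ℝ) (e : Fin M → Fin K → Bool) : Matrix (NoiseIdx M) ι ℝ :=
  Matrix.of fun r i => signalRow β c A B r.1 (e r.1) r.2 i

theorem signOf_sq (b : Bool) : signOf b ^ 2 = 1 := by
  cases b <;> simp [signOf]

theorem sum_sq_add_le {α : Type*} [Fintype α] {p q : α → ℝ} {P Q : ℝ} (hP : 0 ≤ P) (hQ : 0 ≤ Q)
    (hp : ∑ x, p x ^ 2 ≤ P ^ 2) (hq : ∑ x, q x ^ 2 ≤ Q ^ 2) :
    ∑ x, (p x + q x) ^ 2 ≤ (P + Q) ^ 2 := by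
  have h1 : (∑ x, p x * q x) ^ 2 ≤ (P * Q) ^ 2 := by
    rw [mul_pow]
    exact (Finset.sum_mul_sq_le_sq_mul_sq _ _ _).trans
      (mul_le_mul hp hq (Finset.sum_nonneg fun _ _ => sq_nonneg _) (sq_nonneg P))
  have h2 := (abs_le_of_sq_le_sq' h1 (mul_nonneg hP hQ)).2
  have h3 : ∑ x, (p x + q x) ^ 2 = ∑ x, p x ^ 2 + 2 * ∑ x, p x * q x + ∑ x, q x ^ 2 := by
    rw [Finset.mul_sum, ← Finset.sum_add_distrib, ← Finset.sum_add_distrib]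
    exact Finset.sum_congr rfl fun x _ => by ring
  rw [h3]
  nlinarith

/-- Superposing the users does not increase the energy by more than the factor `∑ k, β k ^ 2`. -/
theorem sum_sq_superposition_le {β : Fin K → ℝ} {S : ℝ} (hS : ∑ k, β k ^ 2 ≤ S)
    (e : Fin M → Fin K → Bool) (h : FadingIdx K M → ℝ) :
    ∑ r : NoiseIdx M, (∑ k, signOf (e r.1 k) * (β k * h (r.1, r.2, k))) ^ 2 ≤
      S * ∑ x, h x ^ 2 := by
  have h1 : ∀ r : NoiseIdx M, (∑ k, signOf (e r.1 k) * (β k * h (r.1, r.2, k))) ^ 2 ≤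
      S * ∑ k, h (r.1, r.2, k) ^ 2 := by
    intro r
    have h2 := Finset.sum_mul_sq_le_sq_mul_sq Finset.univ (fun k => signOf (e r.1 k) * β k)
      fun k => h (r.1, r.2, k)
    simp only [mul_pow, signOf_sq, one_mul, mul_assoc] at h2
    exact h2.trans (mul_le_mul_of_nonneg_right hS (Finset.sum_nonneg fun _ _ => sq_nonneg _))
  refine (Finset.sum_le_sum fun r _ => h1 r).trans (le_of_eq ?_)
  rw [← Finset.mul_sum]
  simp only [Fintype.sum_prod_type]

variable [Fintype ι]

theorem signalMatrix_mulVec (β : Fin K → ℝ) (c : ℝ) (A : Matrix (FadingIdx K M) ι ℝ)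
    (B : Matrix (NoiseIdx M) ι ℝ) (e : Fin M → Fin K → Bool) (x : ι → ℝ) (r : NoiseIdx M) :
    (signalMatrix β c A B e *ᵥ x) r =
      ∑ k, signOf (e r.1 k) * (β k * (A *ᵥ x) (r.1, r.2, k)) + c * (B *ᵥ x) r := by
  simp only [signalMatrix, signalRow, Matrix.mulVec, dotProduct, Matrix.of_apply, add_mul,
    Finset.sum_add_distrib, Finset.sum_mul, Finset.mul_sum]
  rw [Finset.sum_comm]
  simp only [mul_assoc]

theorem sum_sq_mulVec_le_opNorm {κ : Type*} [Fintype κ] [DecidableEq ι] (A : Matrix κ ι ℝ)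
    (x : ι → ℝ) : ∑ r, (A *ᵥ x) r ^ 2 ≤ opNorm A ^ 2 * ∑ i, x i ^ 2 := by
  have h1 := (LinearMap.toContinuousLinearMap (Matrix.toEuclideanLin A)).le_opNorm (WithLp.toLp 2 x)
  have h2 := pow_le_pow_left₀ (norm_nonneg _) h1 2
  rw [mul_pow, EuclideanSpace.real_norm_sq_eq, EuclideanSpace.real_norm_sq_eq] at h2
  simpa [opNorm] using h2

theorem sum_sq_signalMatrix_mulVec_le [DecidableEq ι] {β : Fin K → ℝ} {c S : ℝ} (hc : 0 ≤ c)
    (hS : ∑ k, β k ^ 2 ≤ S) (A : Matrix (FadingIdx K M) ι ℝ) (B : Matrix (NoiseIdx M) ι ℝ)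
    (e : Fin M → Fin K → Bool) (x : ι → ℝ) :
    ∑ r, (signalMatrix β c A B e *ᵥ x) r ^ 2 ≤
      (√S * opNorm A + c * opNorm B) ^ 2 * ∑ i, x i ^ 2 := by
  have hS0 : 0 ≤ S := (Finset.sum_nonneg fun _ _ => sq_nonneg _).trans hS
  have hx : 0 ≤ ∑ i, x i ^ 2 := Finset.sum_nonneg fun _ _ => sq_nonneg _
  have hA : 0 ≤ opNorm A := norm_nonneg _
  have hB : 0 ≤ opNorm B := norm_nonneg _
  simp_rw [signalMatrix_mulVec]
  have hsplit : (√S * opNorm A + c * opNorm B) ^ 2 * ∑ i, x i ^ 2 =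
      (√S * opNorm A * √(∑ i, x i ^ 2) + c * opNorm B * √(∑ i, x i ^ 2)) ^ 2 := by
    rw [← add_mul, mul_pow, Real.sq_sqrt hx]
  rw [hsplit]
  refine sum_sq_add_le (by positivity) (by positivity) ?_ ?_
  · refine (sum_sq_superposition_le hS e (A *ᵥ x)).trans ?_
    rw [mul_pow, mul_pow, Real.sq_sqrt hS0, Real.sq_sqrt hx, mul_assoc]
    exact mul_le_mul_of_nonneg_left (sum_sq_mulVec_le_opNorm A x) hS0
  · simp_rw [mul_pow]
    rw [← Finset.mul_sum, Real.sq_sqrt hx, mul_assoc]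
    exact mul_le_mul_of_nonneg_left (sum_sq_mulVec_le_opNorm B x) (sq_nonneg c)

theorem sum_sq_signalMatrix_le {β : Fin K → ℝ} {c S : ℝ} (hc : 0 ≤ c)
    (hS : ∑ k, β k ^ 2 ≤ S) (A : Matrix (FadingIdx K M) ι ℝ) (B : Matrix (NoiseIdx M) ι ℝ)
    (e : Fin M → Fin K → Bool) :
    ∑ r, ∑ i, signalMatrix β c A B e r i ^ 2 ≤ (√S * frobNorm A + c * frobNorm B) ^ 2 := by
  have hS0 : 0 ≤ S := (Finset.sum_nonneg fun _ _ => sq_nonneg _).trans hS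
  have hA : 0 ≤ frobNorm A := Real.sqrt_nonneg _
  have hB : 0 ≤ frobNorm B := Real.sqrt_nonneg _
  have hsqA : frobNorm A ^ 2 = ∑ x, ∑ i, A x i ^ 2 :=
    Real.sq_sqrt (Finset.sum_nonneg fun _ _ => Finset.sum_nonneg fun _ _ => sq_nonneg _)
  have hsqB : frobNorm B ^ 2 = ∑ x, ∑ i, B x i ^ 2 :=
    Real.sq_sqrt (Finset.sum_nonneg fun _ _ => Finset.sum_nonneg fun _ _ => sq_nonneg _)
  rw [← Fintype.sum_prod_type' (f := fun r i => signalMatrix β c A B e r i ^ 2)]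
  refine sum_sq_add_le (α := NoiseIdx M × ι)
    (p := fun x => ∑ k, signOf (e x.1.1 k) * (β k * A (x.1.1, x.1.2, k) x.2))
    (q := fun x => c * B x.1 x.2) (by positivity) (by positivity) ?_ ?_
  · rw [Fintype.sum_prod_type, Finset.sum_comm, mul_pow, Real.sq_sqrt hS0, hsqA,
      Finset.sum_comm (s := (Finset.univ : Finset (FadingIdx K M))), Finset.mul_sum]
    exact Finset.sum_le_sum fun i _ => sum_sq_superposition_le hS e fun x => A x i
  · rw [mul_pow, hsqB, Fintype.sum_prod_type]
    simp_rw [mul_pow, ← Finset.mul_sum]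
    exact le_rfl

theorem sum_sq_row_le {κ : Type*} [Fintype κ] (T : Matrix κ ι ℝ) {a : ℝ} (ha : 0 ≤ a)
    (hT : ∀ x : ι → ℝ, ∑ r, (T *ᵥ x) r ^ 2 ≤ a * ∑ i, x i ^ 2) (r : κ) :
    ∑ i, T r i ^ 2 ≤ a := by
  classical
  have := sum_sq_transpose_mulVec_le T ha hT (Pi.single r 1)
  simpa [Pi.single_apply] using this

/-! ### Concentration of the received energy -/

/-- The expected contribution of channel use `m` to the received energy, given that the users send
the signs `v`; here `σ i` is the variance of the `i`-th independent variable. -/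
def meanEnergy (β : Fin K → ℝ) (c : ℝ) (A : Matrix (FadingIdx K M) ι ℝ)
    (B : Matrix (NoiseIdx M) ι ℝ) (σ : ι → ℝ) (m : Fin M) (v : Fin K → Bool) : ℝ :=
  ∑ j, ∑ i, signalRow β c A B m v j i ^ 2 * σ i

theorem integral_meanEnergy (β : Fin K → ℝ) (c : ℝ) (A : Matrix (FadingIdx K M) ι ℝ)
    (B : Matrix (NoiseIdx M) ι ℝ) (σ : ι → ℝ) (m : Fin M) :
    ∫ v, meanEnergy β c A B σ m v ∂Measure.pi (fun _ => fairBool) =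
      ∑ j, ∑ i, (∑ k, (β k * A (m, j, k) i) ^ 2 + (c * B (m, j) i) ^ 2) * σ i := by
  simp only [meanEnergy]
  rw [integral_finsetSum _ fun _ _ => .of_finite]
  refine Finset.sum_congr rfl fun j _ => ?_
  rw [integral_finsetSum _ fun _ _ => .of_finite]
  refine Finset.sum_congr rfl fun i _ => ?_
  rw [integral_mul_const]
  simp only [signalRow]
  rw [integral_sq_sum_signOf]

/-- The conditional expectation of the energy given the signs concentrates, by Hoeffding's
inequality: it is a sum over the channel uses of independent terms in `[0, 2 w m]`, where `w m` is
the maximal squared norm of the rows for `m`. Choosing maximizing signs for all `m` at once shows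
that `∑ m, w m` is at most the bound `f` on the squared Frobenius norm, while `w m ≤ 2 a`. -/
theorem lintegral_exp_meanEnergy_le (β : Fin K → ℝ) (c : ℝ) (A : Matrix (FadingIdx K M) ι ℝ)
    (B : Matrix (NoiseIdx M) ι ℝ) {σ : ι → ℝ} (hσ0 : ∀ i, 0 ≤ σ i) (hσ : ∀ i, σ i ≤ 2)
    {a f : ℝ} (ha : 0 ≤ a)
    (hop : ∀ e x, ∑ r, (signalMatrix β c A B e *ᵥ x) r ^ 2 ≤ a * ∑ i, x i ^ 2)
    (hF : ∀ e, ∑ r, ∑ i, signalMatrix β c A B e r i ^ 2 ≤ f) (l : ℝ) :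
    ∫⁻ e, ENNReal.ofReal (Real.exp (l * (∑ m, (meanEnergy β c A B σ m (e m) -
        ∫ v, meanEnergy β c A B σ m v ∂Measure.pi (fun _ => fairBool)))))
        ∂Measure.pi (fun _ : Fin M => Measure.pi fun _ : Fin K => fairBool) ≤
      ENNReal.ofReal (Real.exp (l ^ 2 * (a * f))) := by
  let ρ : Measure (Fin K → Bool) := Measure.pi fun _ => fairBool
  let w : Fin M → (Fin K → Bool) → ℝ := fun m v => ∑ j, ∑ i, signalRow β c A B m v j i ^ 2
  have hmax : ∀ m, ∃ v₀, ∀ v, w m v ≤ w m v₀ := fun m => Finite.exists_max (w m)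
  choose e₀ he₀ using hmax
  have hw0 : ∀ m v, 0 ≤ w m v := fun m v =>
    Finset.sum_nonneg fun _ _ => Finset.sum_nonneg fun _ _ => sq_nonneg _
  have hg : ∀ m v, meanEnergy β c A B σ m v ∈ Set.Icc 0 (2 * w m (e₀ m)) := by
    intro m v
    refine ⟨Finset.sum_nonneg fun _ _ => Finset.sum_nonneg fun i _ =>
      mul_nonneg (sq_nonneg _) (hσ0 i), le_trans ?_ (mul_le_mul_of_nonneg_left (he₀ m v) two_pos.le)⟩
    simp only [meanEnergy, w, Finset.mul_sum]
    refine Finset.sum_le_sum fun j _ => Finset.sum_le_sum fun i _ => ?_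
    nlinarith [mul_le_mul_of_nonneg_left (hσ i) (sq_nonneg (signalRow β c A B m v j i))]
  have hsub : ∀ m, HasSubgaussianMGF
      (fun e : Fin M → Fin K → Bool => meanEnergy β c A B σ m (e m) -
        ∫ v, meanEnergy β c A B σ m v ∂ρ)
      ((‖2 * w m (e₀ m) - 0‖₊ / 2) ^ 2) (Measure.pi fun _ => ρ) := by
    intro m
    have h1 := hasSubgaussianMGF_of_mem_Icc (μ := ρ) (X := meanEnergy β c A B σ m)
      (measurable_of_finite _).aemeasurable (.of_forall (hg m))
    have h2 := (measurePreserving_eval (fun _ : Fin M => ρ) m).map_eq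
    refine HasSubgaussianMGF.of_map (μ := Measure.pi fun _ : Fin M => ρ) (Y := Function.eval m)
      (X := fun v => meanEnergy β c A B σ m v - ∫ v, meanEnergy β c A B σ m v ∂ρ)
      (measurable_pi_apply m).aemeasurable ?_
    rw [h2]
    exact h1
  have hind : iIndepFun (fun m (e : Fin M → Fin K → Bool) => meanEnergy β c A B σ m (e m) -
      ∫ v, meanEnergy β c A B σ m v ∂ρ) (Measure.pi fun _ => ρ) :=
    iIndepFun_pi (μ := fun _ : Fin M => ρ) (X := fun m v => meanEnergy β c A B σ m v -
      ∫ v, meanEnergy β c A B σ m v ∂ρ) fun m => (measurable_of_finite _).aemeasurable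
  have hsum := HasSubgaussianMGF.sum_of_iIndepFun hind (s := Finset.univ) fun m _ => hsub m
  refine (hsum.lintegral_exp_mul_le l).trans (ENNReal.ofReal_le_ofReal (Real.exp_le_exp.2 ?_))
  have hwa : ∀ m, w m (e₀ m) ≤ 2 * a := by
    intro m
    have h1 : ∀ j, ∑ i, signalRow β c A B m (e₀ m) j i ^ 2 ≤ a := fun j =>
      sum_sq_row_le (signalMatrix β c A B e₀) ha (hop e₀) (m, j)
    simp only [w, Fin.sum_univ_two]
    linarith [h1 0, h1 1]
  have hwf : ∑ m, w m (e₀ m) ≤ f := by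
    have := hF e₀
    rw [Fintype.sum_prod_type] at this
    exact this
  have hpar : ((∑ m, (‖2 * w m (e₀ m) - 0‖₊ / 2) ^ 2 : ℝ≥0) : ℝ) = ∑ m, w m (e₀ m) ^ 2 := by
    push_cast
    refine Finset.sum_congr rfl fun m _ => ?_
    rw [sub_zero, Real.norm_eq_abs, abs_of_nonneg (mul_nonneg two_pos.le (hw0 _ _))]
    ring
  rw [hpar]
  have hsq : ∑ m, w m (e₀ m) ^ 2 ≤ 2 * (a * f) := by
    calc ∑ m, w m (e₀ m) ^ 2 ≤ ∑ m, 2 * a * w m (e₀ m) :=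
          Finset.sum_le_sum fun m _ => by
            rw [sq]; exact mul_le_mul_of_nonneg_right (hwa m) (hw0 _ _)
      _ = 2 * a * ∑ m, w m (e₀ m) := by rw [Finset.mul_sum]
      _ ≤ 2 * a * f := mul_le_mul_of_nonneg_left hwf (by positivity)
      _ = _ := by ring
  nlinarith [mul_le_mul_of_nonneg_left hsq (sq_nonneg l)]

/-- Exponential moments of the deviation of the received energy from its expectation. Given the
signs, the energy deviates little from its conditional expectation by the Hanson–Wright inequality,
and the conditional expectation is controlled by `lintegral_exp_meanEnergy_le`. -/
theorem lintegral_exp_energy_le (ν : ι → Measure ℝ) [∀ i, IsProbabilityMeasure (ν i)]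
    (hν : ∀ i, HasSubgaussianMGF (fun x => x) 1 (ν i)) (β : Fin K → ℝ) (c : ℝ)
    (A : Matrix (FadingIdx K M) ι ℝ) (B : Matrix (NoiseIdx M) ι ℝ) {a f : ℝ} (ha : 0 ≤ a)
    (hop : ∀ e x, ∑ r, (signalMatrix β c A B e *ᵥ x) r ^ 2 ≤ a * ∑ i, x i ^ 2)
    (hF : ∀ e, ∑ r, ∑ i, signalMatrix β c A B e r i ^ 2 ≤ f) {l : ℝ} (hl : |l| * a ≤ 1 / 16) :
    ∫⁻ e, ∫⁻ x, ENNReal.ofReal (Real.exp (l * (∑ r, (signalMatrix β c A B e *ᵥ x) r ^ 2 -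
        ∑ m, ∑ j, ∑ i, (∑ k, (β k * A (m, j, k) i) ^ 2 + (c * B (m, j) i) ^ 2) *
          ∫ y, y ^ 2 ∂ν i))) ∂Measure.pi ν
        ∂Measure.pi (fun _ : Fin M => Measure.pi fun _ : Fin K => fairBool) ≤
      ENNReal.ofReal (Real.exp (49 * l ^ 2 * (a * f))) := by
  set σ : ι → ℝ := fun i => ∫ y, y ^ 2 ∂ν i
  have hσ0 : ∀ i, 0 ≤ σ i := fun i => integral_nonneg fun y => sq_nonneg y
  have hσ2 : ∀ i, σ i ≤ 2 := fun i => (hν i).integral_sq_le_two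
  let E : (Fin M → Fin K → Bool) → ℝ := fun e => ∑ m, (meanEnergy β c A B σ m (e m) -
    ∫ v, meanEnergy β c A B σ m v ∂Measure.pi (fun _ => fairBool))
  have hsplit : ∀ (e : Fin M → Fin K → Bool) (x : ι → ℝ),
      ENNReal.ofReal (Real.exp (l * (∑ r, (signalMatrix β c A B e *ᵥ x) r ^ 2 -
        ∑ m, ∑ j, ∑ i, (∑ k, (β k * A (m, j, k) i) ^ 2 + (c * B (m, j) i) ^ 2) * σ i))) =
      ENNReal.ofReal (Real.exp (l * E e)) *
        ENNReal.ofReal (Real.exp (l * (∑ r, (signalMatrix β c A B e *ᵥ x) r ^ 2 -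
          ∑ i, (∑ r, signalMatrix β c A B e r i ^ 2) * σ i))) := by
    intro e x
    have h1 : ∑ m, meanEnergy β c A B σ m (e m) =
        ∑ i, (∑ r, signalMatrix β c A B e r i ^ 2) * σ i := by
      simp_rw [Finset.sum_mul]
      rw [Finset.sum_comm, Fintype.sum_prod_type]
      rfl
    rw [← ENNReal.ofReal_mul (Real.exp_pos _).le, ← Real.exp_add, ← h1]
    simp only [E, Finset.sum_sub_distrib, integral_meanEnergy]
    congr 2
    ring
  calc _ = ∫⁻ e, ENNReal.ofReal (Real.exp (l * E e)) *
        ∫⁻ x, ENNReal.ofReal (Real.exp (l * (∑ r, (signalMatrix β c A B e *ᵥ x) r ^ 2 -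
          ∑ i, (∑ r, signalMatrix β c A B e r i ^ 2) * σ i))) ∂Measure.pi ν
        ∂Measure.pi (fun _ : Fin M => Measure.pi fun _ : Fin K => fairBool) := by
        refine lintegral_congr fun e => ?_
        rw [← lintegral_const_mul' _ _ ENNReal.ofReal_ne_top]
        exact lintegral_congr fun x => hsplit e x
    _ ≤ ∫⁻ e, ENNReal.ofReal (Real.exp (l * E e)) *
          ENNReal.ofReal (Real.exp (48 * l ^ 2 * (a * f)))
        ∂Measure.pi (fun _ : Fin M => Measure.pi fun _ : Fin K => fairBool) := by
        gcongr with e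
        exact lintegral_exp_hansonWright_le ν hν _ ha (hop e) (hF e) hl
    _ ≤ ENNReal.ofReal (Real.exp (l ^ 2 * (a * f))) *
          ENNReal.ofReal (Real.exp (48 * l ^ 2 * (a * f))) := by
        rw [lintegral_mul_const' _ _ ENNReal.ofReal_ne_top]
        gcongr
        exact lintegral_exp_meanEnergy_le β c A B hσ0 hσ2 ha hop hF l
    _ = _ := by
        rw [← ENNReal.ofReal_mul (Real.exp_pos _).le, ← Real.exp_add]
        congr 2
        ring

end SignalMatrix

/-! ### Tail bound from exponential moments -/

/-- Chernoff's bound for a variable with sub-gamma exponential moments. -/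
theorem measureReal_abs_ge_le {Ω : Type*} [MeasurableSpace Ω] {μ : Measure Ω}
    [IsProbabilityMeasure μ] {Z : Ω → ℝ} (hZ : Measurable Z) {a v : ℝ} (ha : 0 ≤ a) (hv : 0 ≤ v)
    (h : ∀ l : ℝ, |l| * a ≤ 1 / 16 →
      ∫⁻ ω, ENNReal.ofReal (Real.exp (l * Z ω)) ∂μ ≤ ENNReal.ofReal (Real.exp (64 * l ^ 2 * v)))
    {z : ℝ} (hz : 0 ≤ z) :
    μ.real {ω | z ≤ |Z ω|} ≤ 2 * Real.exp (-(z ^ 2 / (256 * v + 32 * z * a))) := by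
  set d := 128 * v + 16 * z * a with hd
  have hd0 : 0 ≤ d := by positivity
  have hden : 256 * v + 32 * z * a = 2 * d := by rw [hd]; ring
  rw [hden]
  rcases hd0.eq_or_lt with h0 | h0
  · rw [← h0]
    simpa using measureReal_le_one.trans one_le_two
  -- The exponent `-l z + 64 l² v` at `l = ± z / d`, where `64 v ≤ d / 2`, is at most `-z² / (2 d)`.
  have hone : ∀ s : ℝ, |s| = 1 → μ.real {ω | z ≤ s * Z ω} ≤ Real.exp (-(z ^ 2 / (2 * d))) := by
    intro s hs
    have hs2 : s ^ 2 = 1 := by rw [← sq_abs, hs, one_pow]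
    set l := z / d
    have hl0 : 0 ≤ l := div_nonneg hz h0.le
    have hld : l * d = z := div_mul_cancel₀ _ h0.ne'
    have hla : |s * l| * a ≤ 1 / 16 := by
      rw [abs_mul, hs, one_mul, abs_of_nonneg hl0, div_mul_eq_mul_div, div_le_div_iff₀ h0 (by norm_num)]
      linarith
    have hm := mul_meas_ge_le_lintegral₀ (μ := μ)
      (f := fun ω => ENNReal.ofReal (Real.exp (s * l * Z ω))) (by fun_prop)
      (ENNReal.ofReal (Real.exp (l * z)))
    have hsubset : {ω | z ≤ s * Z ω} ⊆ {ω | ENNReal.ofReal (Real.exp (l * z)) ≤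
        ENNReal.ofReal (Real.exp (s * l * Z ω))} := by
      intro ω hω
      refine ENNReal.ofReal_le_ofReal (Real.exp_le_exp.2 ?_)
      have : z ≤ s * Z ω := hω
      nlinarith
    have h1 : ENNReal.ofReal (Real.exp (l * z)) * μ {ω | z ≤ s * Z ω} ≤
        ENNReal.ofReal (Real.exp (64 * (s * l) ^ 2 * v)) :=
      (mul_le_mul_right (measure_mono hsubset) _).trans (hm.trans (h (s * l) hla))
    have h2 := ENNReal.toReal_mono ENNReal.ofReal_ne_top h1
    rw [ENNReal.toReal_mul, ENNReal.toReal_ofReal (Real.exp_pos _).le,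
      ENNReal.toReal_ofReal (Real.exp_pos _).le, mul_pow, hs2, one_mul] at h2
    have h3 : μ.real {ω | z ≤ s * Z ω} ≤ Real.exp (64 * l ^ 2 * v - l * z) := by
      rw [Real.exp_sub, le_div_iff₀ (Real.exp_pos _), mul_comm]
      exact h2
    refine h3.trans (Real.exp_le_exp.2 ?_)
    have h4 : z ^ 2 / (2 * d) = l ^ 2 * d / 2 := by
      rw [← hld]
      field_simp
    have h5 : 128 * v ≤ d := by
      have : 0 ≤ 16 * z * a := by positivity
      linarith
    rw [h4]
    have h6 : l * z = l ^ 2 * d := by rw [← hld]; ring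
    nlinarith [mul_le_mul_of_nonneg_left h5 (sq_nonneg l)]
  have hsub : {ω | z ≤ |Z ω|} ⊆ {ω | z ≤ 1 * Z ω} ∪ {ω | z ≤ -1 * Z ω} := by
    intro ω hω
    rcases le_abs.1 (show z ≤ |Z ω| from hω) with h1 | h1
    · left; simpa using h1
    · right; simpa using h1
  calc μ.real {ω | z ≤ |Z ω|} ≤ μ.real {ω | z ≤ 1 * Z ω} + μ.real {ω | z ≤ -1 * Z ω} :=
        (measureReal_mono hsub).trans (measureReal_union_le _ _)
    _ ≤ _ := by linarith [hone 1 (by simp), hone (-1) (by simp)]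

/-! ### The independent variables behind the channel -/

/-- The infimum in the sub-gaussian norm is attained. -/
theorem hasSubgaussianMGF_of_subGaussianNorm_le_one {Ω : Type*} [MeasurableSpace Ω] {μ : Measure Ω}
    {X : Ω → ℝ} (h : subGaussianNorm X μ ≤ 1) :
    HasSubgaussianMGF (fun ω => X ω - ∫ ω', X ω' ∂μ) 1 μ := by
  have h1 : ∀ s : ℝ≥0, 1 < s → ∃ t : ℝ≥0, t < s ∧
      HasSubgaussianMGF (fun ω => X ω - ∫ ω', X ω' ∂μ) (t ^ 2) μ := by
    intro s hs
    have hlt : subGaussianNorm X μ < (s : ℝ≥0∞) := h.trans_lt (by exact_mod_cast hs)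
    simp only [subGaussianNorm, iInf_lt_iff] at hlt
    obtain ⟨t, ⟨_, ht⟩, hts⟩ := hlt
    exact ⟨t, by exact_mod_cast hts, ht⟩
  obtain ⟨t₀, _, ht₀⟩ := h1 2 one_lt_two
  refine ⟨ht₀.integrable_exp_mul, fun l => ?_⟩
  have hlim : Filter.Tendsto (fun s : ℝ => Real.exp (s ^ 2 * l ^ 2 / 2)) (nhdsWithin 1 (Set.Ioi 1))
      (nhds (Real.exp (((1 : ℝ≥0) : ℝ) * l ^ 2 / 2))) := by
    have : Continuous fun s : ℝ => Real.exp (s ^ 2 * l ^ 2 / 2) := by fun_prop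
    refine (this.tendsto' 1 _ ?_).mono_left nhdsWithin_le_nhds
    simp
  refine ge_of_tendsto hlim ?_
  filter_upwards [self_mem_nhdsWithin] with s hs
  have hs : 1 < s := hs
  obtain ⟨t, hts, ht⟩ := h1 ⟨s, by linarith⟩ (by exact_mod_cast hs)
  refine (ht.mgf_le l).trans (Real.exp_le_exp.2 ?_)
  have hts' : (t : ℝ) ≤ s := by exact_mod_cast hts.le
  have : ((t ^ 2 : ℝ≥0) : ℝ) ≤ s ^ 2 := by
    push_cast
    exact pow_le_pow_left₀ t.2 hts' 2
  nlinarith [mul_le_mul_of_nonneg_right this (sq_nonneg l)]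

/-- The source variables, recentered. -/
def centered {Ω : Type*} [MeasurableSpace Ω] {ι : Type*} (R : ι → Ω → ℝ) (μ : Measure Ω)
    (ω : Ω) (i : ι) : ℝ := R i ω - ∫ ω', R i ω' ∂μ

namespace IsCorrelatedChannel

variable {Ω : Type*} [MeasurableSpace Ω] {K M : ℕ} {μ : Measure Ω}
  {R : SourceIdx K M → Ω → ℝ}
  {A : Matrix (FadingIdx K M) (SourceIdx K M) ℝ} {B : Matrix (NoiseIdx M) (SourceIdx K M) ℝ}
  {H : Fin K → Fin M → Ω → ℂ} {N : Fin M → Ω → ℂ}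

theorem hasSubgaussianMGF_centered (h : IsCorrelatedChannel μ R A B H N) (i : SourceIdx K M) :
    HasSubgaussianMGF (fun ω => centered R μ ω i) 1 μ :=
  hasSubgaussianMGF_of_subGaussianNorm_le_one (h.norm_le i)

theorem measurable_centered (h : IsCorrelatedChannel μ R A B H N) (i : SourceIdx K M) :
    Measurable fun ω => centered R μ ω i :=
  (h.measurable i).sub_const _

theorem measurable_mulVec_centered (h : IsCorrelatedChannel μ R A B H N) {κ : Type*}
    (C : Matrix κ (SourceIdx K M) ℝ) (x : κ) : Measurable fun ω => (C *ᵥ centered R μ ω) x := by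
  have := h.measurable_centered
  simp only [Matrix.mulVec, dotProduct]
  fun_prop

theorem memLp_mulVec_centered (h : IsCorrelatedChannel μ R A B H N) {κ : Type*}
    (C : Matrix κ (SourceIdx K M) ℝ) (x : κ) :
    MemLp (fun ω => (C *ᵥ centered R μ ω) x) 2 μ := by
  simp only [Matrix.mulVec, dotProduct]
  exact memLp_finsetSum _ fun i _ => ((h.hasSubgaussianMGF_centered i).memLp 2).const_mul _

theorem hasSubgaussianMGF_map_centered (h : IsCorrelatedChannel μ R A B H N)
    (i : SourceIdx K M) : HasSubgaussianMGF (fun y => y) 1 (μ.map fun ω => centered R μ ω i) :=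
  (HasSubgaussianMGF.id_map_iff (h.measurable_centered i).aemeasurable).2
    (h.hasSubgaussianMGF_centered i)

variable [IsProbabilityMeasure μ]

theorem isProbabilityMeasure_map_centered (h : IsCorrelatedChannel μ R A B H N)
    (i : SourceIdx K M) : IsProbabilityMeasure (μ.map fun ω => centered R μ ω i) :=
  Measure.isProbabilityMeasure_map (h.measurable_centered i).aemeasurable

theorem integrable (h : IsCorrelatedChannel μ R A B H N) (i : SourceIdx K M) :
    Integrable (R i) μ := by
  have := (h.hasSubgaussianMGF_centered i).integrable.add (integrable_const (∫ ω', R i ω' ∂μ))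
  refine this.congr (.of_forall fun ω => ?_)
  simp [centered]

theorem integral_centered (h : IsCorrelatedChannel μ R A B H N) (i : SourceIdx K M) :
    ∫ ω, centered R μ ω i ∂μ = 0 := by
  simp only [centered]
  rw [integral_sub (h.integrable i) (integrable_const _)]
  simp

theorem map_centered (h : IsCorrelatedChannel μ R A B H N) :
    μ.map (centered R μ) = Measure.pi fun i => μ.map fun ω => centered R μ ω i := by
  have h1 : iIndepFun (fun i ω => centered R μ ω i) μ :=
    h.indep.comp (fun i x => x - ∫ ω', R i ω' ∂μ) fun i => measurable_id.sub_const _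
  exact (iIndepFun_iff_map_fun_eq_pi_map fun i => (h.measurable_centered i).aemeasurable).1 h1

/-- Fading and noise are centered, so that the means of the source variables cancel. -/
theorem mulVec_centered (h : IsCorrelatedChannel μ R A B H N) {κ : Type*}
    (C : Matrix κ (SourceIdx K M) ℝ) {x : κ} (hx : ∫ ω, linImage C R x ω ∂μ = 0) (ω : Ω) :
    (C *ᵥ centered R μ ω) x = linImage C R x ω := by
  simp only [linImage, Matrix.mulVec, dotProduct] at hx ⊢
  rw [integral_finsetSum _ fun i _ => (h.integrable i).const_mul _] at hx
  simp only [integral_const_mul] at hx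
  simp only [centered, mul_sub, Finset.sum_sub_distrib]
  linarith

theorem integral_sq_mulVec_centered (h : IsCorrelatedChannel μ R A B H N) {κ : Type*}
    (C : Matrix κ (SourceIdx K M) ℝ) (x : κ) :
    ∫ ω, (C *ᵥ centered R μ ω) x ^ 2 ∂μ =
      ∑ i, C x i ^ 2 * ∫ y, y ^ 2 ∂(μ.map fun ω => centered R μ ω i) := by
  have hprob := h.isProbabilityMeasure_map_centered
  have hsub := h.hasSubgaussianMGF_map_centered
  have hmean : ∀ i, ∫ y, C x i * y ∂(μ.map fun ω => centered R μ ω i) = 0 := by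
    intro i
    have h1 := integral_map (μ := μ) (h.measurable_centered i).aemeasurable (f := fun y : ℝ => y)
      measurable_id.aestronglyMeasurable
    rw [integral_const_mul, h1, h.integral_centered, mul_zero]
  have key := integral_sq_sum_pi (fun i => μ.map fun ω => centered R μ ω i)
    (Z := fun i y => C x i * y) (fun i => ((hsub i).memLp 2).const_mul _) hmean 0
  rw [← h.map_centered, integral_map (measurable_pi_iff.2 h.measurable_centered).aemeasurable
    (by fun_prop : Measurable _).aestronglyMeasurable] at key
  simp only [add_zero, mul_pow, integral_const_mul, ne_eq, OfNat.ofNat_ne_zero, not_false_eq_true,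
    zero_pow] at key
  exact key

theorem re_eq (h : IsCorrelatedChannel μ R A B H N) (k : Fin K) (m : Fin M) (ω : Ω) :
    (H k m ω).re = (A *ᵥ centered R μ ω) (m, 0, k) := by
  rw [h.mulVec_centered A _ ω, h.fading_re]
  simpa only [h.fading_re] using h.fading_mean_re k m

theorem im_eq (h : IsCorrelatedChannel μ R A B H N) (k : Fin K) (m : Fin M) (ω : Ω) :
    (H k m ω).im = (A *ᵥ centered R μ ω) (m, 1, k) := by
  rw [h.mulVec_centered A _ ω, h.fading_im]
  simpa only [h.fading_im] using h.fading_mean_im k m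

theorem noise_re_eq (h : IsCorrelatedChannel μ R A B H N) (m : Fin M) (ω : Ω) :
    (N m ω).re = (B *ᵥ centered R μ ω) (m, 0) := by
  rw [h.mulVec_centered B _ ω, h.noise_re]
  simpa only [h.noise_re] using h.noise_mean_re m

theorem noise_im_eq (h : IsCorrelatedChannel μ R A B H N) (m : Fin M) (ω : Ω) :
    (N m ω).im = (B *ᵥ centered R μ ω) (m, 1) := by
  rw [h.mulVec_centered B _ ω, h.noise_im]
  simpa only [h.noise_im] using h.noise_mean_im m

/-- The variance of a fading coefficient in terms of the source variables. -/
theorem sum_sq_fading (h : IsCorrelatedChannel μ R A B H N) (m : Fin M) (j : Fin 2) (k : Fin K) :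
    ∑ i, A (m, j, k) i ^ 2 * ∫ y, y ^ 2 ∂(μ.map fun ω => centered R μ ω i) = 1 := by
  rw [← h.integral_sq_mulVec_centered A (m, j, k)]
  fin_cases j
  · have h1 := h.fading_var_re k m
    have h2 := h.fading_mean_re k m
    simp only [h.re_eq] at h1 h2
    rwa [variance_of_integral_eq_zero (h.measurable_mulVec_centered A _).aemeasurable h2] at h1
  · have h1 := h.fading_var_im k m
    have h2 := h.fading_mean_im k m
    simp only [h.im_eq] at h1 h2
    rwa [variance_of_integral_eq_zero (h.measurable_mulVec_centered A _).aemeasurable h2] at h1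

theorem noiseEnergy_eq (h : IsCorrelatedChannel μ R A B H N) :
    noiseEnergy N μ =
      ∑ m, ∑ j, ∑ i, B (m, j) i ^ 2 * ∫ y, y ^ 2 ∂(μ.map fun ω => centered R μ ω i) := by
  simp only [noiseEnergy, energy, Complex.sq_norm, Complex.normSq_apply, h.noise_re_eq,
    h.noise_im_eq, ← sq]
  have hint : ∀ x, Integrable (fun ω => (B *ᵥ centered R μ ω) x ^ 2) μ := fun x =>
    (h.memLp_mulVec_centered B x).integrable_sq
  have hint2 : ∀ m : Fin M, Integrable (fun ω => (B *ᵥ centered R μ ω) (m, 0) ^ 2 +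
      (B *ᵥ centered R μ ω) (m, 1) ^ 2) μ := fun m => (hint (m, 0)).add (hint (m, 1))
  rw [integral_finsetSum _ fun m _ => hint2 m]
  refine Finset.sum_congr rfl fun m _ => ?_
  rw [integral_add (hint (m, 0)) (hint (m, 1)), Fin.sum_univ_two,
    h.integral_sq_mulVec_centered, h.integral_sq_mulVec_centered]

/-- Tail bound for the received energy. -/
theorem measureReal_energy_le (h : IsCorrelatedChannel μ R A B H N) {β : Fin K → ℝ} {c S : ℝ}
    (hc : 0 ≤ c) (hS : ∑ k, β k ^ 2 ≤ S) {z : ℝ} (hz : 0 ≤ z) :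
    (μ.prod (Measure.pi fun _ : Fin K => Measure.pi fun _ : Fin M => fairBool)).real
      {p | z ≤ |∑ r, (signalMatrix β c A B (fun m k => p.2 k m) *ᵥ centered R μ p.1) r ^ 2 -
        (2 * M * ∑ k, β k ^ 2 + c ^ 2 * noiseEnergy N μ)|} ≤
      2 * Real.exp (-(z ^ 2 / (256 * ((√S * opNorm A + c * opNorm B) ^ 2 *
        (√S * frobNorm A + c * frobNorm B) ^ 2) + 32 * z * (√S * opNorm A + c * opNorm B) ^ 2))) := by
  have hprob := h.isProbabilityMeasure_map_centered
  have hsub := h.hasSubgaussianMGF_map_centered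
  have hX : Measurable (centered R μ) := measurable_pi_iff.2 h.measurable_centered
  have hmean : ∑ m, ∑ j, ∑ i, (∑ k, (β k * A (m, j, k) i) ^ 2 + (c * B (m, j) i) ^ 2) *
        ∫ y, y ^ 2 ∂(μ.map fun ω => centered R μ ω i) =
      2 * M * ∑ k, β k ^ 2 + c ^ 2 * noiseEnergy N μ := by
    have h1 : ∀ m j, ∑ i, (∑ k, (β k * A (m, j, k) i) ^ 2 + (c * B (m, j) i) ^ 2) *
        ∫ y, y ^ 2 ∂(μ.map fun ω => centered R μ ω i) = ∑ k, β k ^ 2 +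
          c ^ 2 * ∑ i, B (m, j) i ^ 2 * ∫ y, y ^ 2 ∂(μ.map fun ω => centered R μ ω i) := by
      intro m j
      simp only [add_mul, Finset.sum_add_distrib, Finset.sum_mul, mul_pow, mul_assoc,
        ← Finset.mul_sum]
      rw [Finset.sum_comm]
      simp only [← Finset.mul_sum, h.sum_sq_fading, mul_one]
    simp only [h1, Finset.sum_add_distrib, ← Finset.mul_sum, h.noiseEnergy_eq]
    simp
    ring
  have hmeas : Measurable fun p : Ω × (Fin K → Fin M → Bool) =>
      ∑ r, (signalMatrix β c A B (fun m k => p.2 k m) *ᵥ centered R μ p.1) r ^ 2 -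
        (2 * M * ∑ k, β k ^ 2 + c ^ 2 * noiseEnergy N μ) := by
    have := measurable_signOf
    have h2 := h.measurable_mulVec_centered A
    have h3 := h.measurable_mulVec_centered B
    simp only [signalMatrix_mulVec]
    fun_prop
  refine measureReal_abs_ge_le hmeas (sq_nonneg _) (by positivity) (fun l hl => ?_) hz
  have hE := lintegral_exp_energy_le (fun i => μ.map fun ω => centered R μ ω i) hsub β c A B
    (sq_nonneg (√S * opNorm A + c * opNorm B)) (fun e x => sum_sq_signalMatrix_mulVec_le hc hS A B e x)
    (fun e => sum_sq_signalMatrix_le hc hS A B e) hl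
  rw [hmean, ← h.map_centered] at hE
  rw [lintegral_prod_symm' _ (by fun_prop)]
  have hT : ∀ e : Fin M → Fin K → Bool, Measurable fun x : SourceIdx K M → ℝ =>
      ENNReal.ofReal (Real.exp (l * (∑ r, (signalMatrix β c A B e *ᵥ x) r ^ 2 -
        (2 * M * ∑ k, β k ^ 2 + c ^ 2 * noiseEnergy N μ)))) := by
    intro e
    simp only [Matrix.mulVec, dotProduct]
    fun_prop
  have hmap := fun e => lintegral_map (μ := μ) (hT e) hX
  simp only [hmap] at hE
  have hswap := (measurePreserving_swap_fairBool (Fin K) (Fin M)).lintegral_comp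
    (f := fun e => ∫⁻ ω, ENNReal.ofReal (Real.exp (l *
      (∑ r, (signalMatrix β c A B e *ᵥ centered R μ ω) r ^ 2 -
        (2 * M * ∑ k, β k ^ 2 + c ^ 2 * noiseEnergy N μ)))) ∂μ) (measurable_of_finite _)
  rw [← hswap] at hE
  refine hE.trans (ENNReal.ofReal_le_ofReal (Real.exp_le_exp.2 ?_))
  have : 0 ≤ l ^ 2 * ((√S * opNorm A + c * opNorm B) ^ 2 *
        (√S * frobNorm A + c * frobNorm B) ^ 2) := by positivity
  linarith

end IsCorrelatedChannel

/-! ### The energy scheme -/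

section Scheme

variable {K M : ℕ} {S : Fin K → Set ℝ} {φ : ∀ k, S k → ℝ}

theorem innerMin_le (hb : ∀ k, ∃ C, ∀ s, |φ k s| ≤ C) (k : Fin K) (s : S k) :
    innerMin φ k ≤ φ k s := by
  obtain ⟨C, hC⟩ := hb k
  refine ciInf_le ⟨-C, ?_⟩ s
  rintro _ ⟨t, rfl⟩
  exact (abs_le.1 (hC t)).1

theorem le_innerMax (hb : ∀ k, ∃ C, ∀ s, |φ k s| ≤ C) (k : Fin K) (s : S k) :
    φ k s ≤ innerMax φ k := by
  obtain ⟨C, hC⟩ := hb k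
  refine le_ciSup (f := fun s => φ k s) ⟨C, ?_⟩ s
  rintro _ ⟨t, rfl⟩
  exact (abs_le.1 (hC t)).2

theorem sub_innerMin_le_maxSpread (hb : ∀ k, ∃ C, ∀ s, |φ k s| ≤ C) (k : Fin K) (s : S k) :
    φ k s - innerMin φ k ≤ maxSpread φ :=
  (sub_le_sub_right (le_innerMax hb k s) _).trans
    (le_ciSup (f := fun k => innerMax φ k - innerMin φ k) (Set.finite_range _).bddAbove k)

theorem peakPower_energyScheme (hφ : ∀ k, Measurable (φ k)) (hb : ∀ k, ∃ C, ∀ s, |φ k s| ≤ C)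
    {G : ℝ → ℝ} (hG : Measurable G) {P : ℝ} (hP : 0 ≤ P) (ν : ℝ) :
    (energyScheme M φ hφ G hG P ν).PeakPower P := by
  intro k s u m
  change ‖((√(P / maxSpread φ * (φ k s - innerMin φ k)) * signOf (u m) : ℝ) : ℂ)‖ ^ 2 ≤ P
  have h0 : 0 ≤ φ k s - innerMin φ k := sub_nonneg.2 (innerMin_le hb k s)
  have h1 := sub_innerMin_le_maxSpread hb k s
  have h2 : 0 ≤ maxSpread φ := h0.trans h1
  rw [Complex.norm_real, Real.norm_eq_abs, sq_abs, mul_pow, signOf_sq, mul_one,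
    Real.sq_sqrt (by positivity), div_mul_eq_mul_div]
  exact div_le_of_le_mul₀ h2 hP (mul_le_mul_of_nonneg_left h1 hP)

variable {Ω : Type*} [MeasurableSpace Ω] {μ : Measure Ω} [IsProbabilityMeasure μ]
  {R : SourceIdx K M → Ω → ℝ}
  {A : Matrix (FadingIdx K M) (SourceIdx K M) ℝ} {B : Matrix (NoiseIdx M) (SourceIdx K M) ℝ}
  {H : Fin K → Fin M → Ω → ℂ} {N : Fin M → Ω → ℂ}

/-- Rescaled by `Δ / P`, the energy of the channel output is the squared norm of the effective
channel matrix applied to the independent variables. -/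
theorem scaled_energy_output (h : IsCorrelatedChannel μ R A B H N)
    (hφ : ∀ k, Measurable (φ k)) (hb : ∀ k, ∃ C, ∀ s, |φ k s| ≤ C)
    {G : ℝ → ℝ} (hG : Measurable G) {P : ℝ} (hP : 0 < P) (ν : ℝ) (s : ∀ k, S k)
    (ω : Ω) (u : Fin K → Fin M → Bool) (hΔ : 0 ≤ maxSpread φ) :
    maxSpread φ / P * energy ((energyScheme M φ hφ G hG P ν).output H N s (ω, u)) =
      ∑ r, (signalMatrix (fun k => √(φ k (s k) - innerMin φ k)) √(maxSpread φ / P) A B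
        (fun m k => u k m) *ᵥ centered R μ ω) r ^ 2 := by
  set c := √(maxSpread φ / P) with hc
  have hcsq : maxSpread φ / P = c ^ 2 := (Real.sq_sqrt (by positivity)).symm
  have hamp : ∀ k, c * √(P / maxSpread φ * (φ k (s k) - innerMin φ k)) =
      √(φ k (s k) - innerMin φ k) := by
    intro k
    rw [hc, ← Real.sqrt_mul (by positivity)]
    congr 1
    rcases hΔ.eq_or_lt with h0 | h0
    · -- All inner functions are constant, and both sides vanish.
      have h1 := sub_innerMin_le_maxSpread hb k (s k)
      have h2 := innerMin_le hb k (s k)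
      rw [← h0] at h1 ⊢
      rw [le_antisymm h1 (sub_nonneg.2 h2)]
      simp
    · field_simp
  have hout : ∀ m, (energyScheme M φ hφ G hG P ν).output H N s (ω, u) m =
      ∑ k, H k m ω * ((√(P / maxSpread φ * (φ k (s k) - innerMin φ k)) *
        signOf (u k m) : ℝ) : ℂ) + N m ω := fun m => rfl
  have hre : ∀ m, c * ((energyScheme M φ hφ G hG P ν).output H N s (ω, u) m).re =
      (signalMatrix (fun k => √(φ k (s k) - innerMin φ k)) c A B
        (fun m k => u k m) *ᵥ centered R μ ω) (m, 0) := by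
    intro m
    rw [hout, signalMatrix_mulVec]
    simp only [Complex.add_re, Complex.re_sum, Complex.re_mul_ofReal, mul_add, Finset.mul_sum,
      h.re_eq, h.noise_re_eq]
    congr 1
    refine Finset.sum_congr rfl fun k _ => ?_
    rw [← hamp k]
    ring
  have him : ∀ m, c * ((energyScheme M φ hφ G hG P ν).output H N s (ω, u) m).im =
      (signalMatrix (fun k => √(φ k (s k) - innerMin φ k)) c A B
        (fun m k => u k m) *ᵥ centered R μ ω) (m, 1) := by
    intro m
    rw [hout, signalMatrix_mulVec]
    simp only [Complex.add_im, Complex.im_sum, Complex.im_mul_ofReal, mul_add, Finset.mul_sum,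
      h.im_eq, h.noise_im_eq]
    congr 1
    refine Finset.sum_congr rfl fun k _ => ?_
    rw [← hamp k]
    ring
  rw [Fintype.sum_prod_type, hcsq, energy, Finset.mul_sum]
  refine Finset.sum_congr rfl fun m _ => ?_
  rw [Fin.sum_univ_two, ← hre, ← him, Complex.sq_norm, Complex.normSq_apply]
  ring

/-- An error of at least `ε` forces the received energy to deviate from its expectation by at least
`M Φ⁻¹(ε)`, after rescaling by `Δ / P`. -/
theorem errorProb_energyScheme_le (h : IsCorrelatedChannel μ R A B H N)
    {f : (∀ k, S k) → ℝ} {D : Set ℝ} {F : D → ℝ} {Φ : ℝ≥0 → ℝ≥0}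
    (hf : IsMonRepresentation f φ D F Φ) {G : ℝ → ℝ} (hG : Measurable G)
    (hGF : ∀ (x : ℝ) (y : D) (r : ℝ≥0), 2 * |x - y| < r → |G x - F y| ≤ Φ r)
    (hK : 0 < K) (hM : 0 < M) {P : ℝ} (hP : 0 < P) (s : ∀ k, S k) {ε : ℝ} :
    (energyScheme M φ hf.inner_measurable G hG P (noiseEnergy N μ)).errorProb μ H N f s ε ≤
      2 * Real.exp (-(M * majorantInv Φ ε ^ 2 /
        (256 * constF φ P A B + 32 * majorantInv Φ ε * constL φ P A B))) := by
  have hb := hf.inner_bounded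
  set t := majorantInv Φ ε with ht
  have ht0 : 0 ≤ t := NNReal.coe_nonneg _
  have hM' : (0 : ℝ) < M := by exact_mod_cast hM
  set b : Fin K → ℝ := fun k => φ k (s k) - innerMin φ k with hbdef
  have hb0 : ∀ k, 0 ≤ b k := fun k => sub_nonneg.2 (innerMin_le hb k (s k))
  have hΔ : 0 ≤ maxSpread φ := (hb0 ⟨0, hK⟩).trans (sub_innerMin_le_maxSpread hb _ _)
  have hsumb : ∑ k, √(b k) ^ 2 = ∑ k, b k := Finset.sum_congr rfl fun k _ => Real.sq_sqrt (hb0 k)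
  have hS : ∑ k, √(b k) ^ 2 ≤ totalSpread φ := by
    rw [hsumb]
    exact Finset.sum_le_sum fun k _ => sub_le_sub_right (le_innerMax hb k (s k)) _
  have hc2 : √(maxSpread φ / P) ^ 2 = maxSpread φ / P := Real.sq_sqrt (by positivity)
  have htail := h.measureReal_energy_le (Real.sqrt_nonneg (maxSpread φ / P)) hS
    (mul_nonneg hM'.le ht0)
  have hF : constF φ P A B * M = constL φ P A B *
      (√(totalSpread φ) * frobNorm A + √(maxSpread φ / P) * frobNorm B) ^ 2 := by
    have h1 : √(totalSpread φ / M) = √(totalSpread φ) / √M := Real.sqrt_div' _ hM'.le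
    have h2 : √(maxSpread φ / (P * M)) = √(maxSpread φ / P) / √M := by
      rw [← div_div, Real.sqrt_div' _ hM'.le]
    have h3 : √(totalSpread φ) / √M * frobNorm A + √(maxSpread φ / P) / √M * frobNorm B =
        (√(totalSpread φ) * frobNorm A + √(maxSpread φ / P) * frobNorm B) / √M := by ring
    rw [constF, h1, h2, h3, div_pow, Real.sq_sqrt hM'.le, mul_assoc, div_mul_cancel₀ _ hM'.ne']
  have hexp : (M * t) ^ 2 / (256 * (constL φ P A B *
      (√(totalSpread φ) * frobNorm A + √(maxSpread φ / P) * frobNorm B) ^ 2) +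
        32 * (M * t) * constL φ P A B) =
      M * t ^ 2 / (256 * constF φ P A B + 32 * t * constL φ P A B) := by
    rw [← hF, show (M * t) ^ 2 = M * (M * t ^ 2) by ring,
      show 256 * (constF φ P A B * M) + 32 * (M * t) * constL φ P A B =
        M * (256 * constF φ P A B + 32 * t * constL φ P A B) by ring,
      mul_div_mul_left _ _ hM'.ne']
  rw [← constL, hexp] at htail
  refine le_trans (measureReal_mono ?_) htail
  rintro ⟨ω, u⟩ hp
  change ε ≤ |G (maxSpread φ / (2 * M * P) *
    (energy ((energyScheme M φ hf.inner_measurable G hG P (noiseEnergy N μ)).output H N s (ω, u)) -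
      noiseEnergy N μ) + ∑ k, innerMin φ k) - f s| at hp
  set e := energy
    ((energyScheme M φ hf.inner_measurable G hG P (noiseEnergy N μ)).output H N s (ω, u)) with he
  rw [hf.eq_outer s] at hp
  change M * t ≤ |_|
  rw [← scaled_energy_output h hf.inner_measurable hb hG hP (noiseEnergy N μ) s ω u hΔ, ← he,
    hsumb, hc2]
  set x := maxSpread φ / (2 * M * P) * (e - noiseEnergy N μ) + ∑ k, innerMin φ k with hx
  have hdiff : maxSpread φ / P * e - (2 * M * ∑ k, b k + maxSpread φ / P * noiseEnergy N μ) =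
      2 * M * (x - ∑ k, φ k (s k)) := by
    rw [hx, hbdef, Finset.sum_sub_distrib]
    field_simp
    ring
  rw [hdiff, abs_mul, abs_of_pos (by positivity), mul_assoc, mul_left_comm]
  refine mul_le_mul_of_nonneg_left ?_ hM'.le
  -- Every `r > 2 |x - y|` satisfies `ε ≤ Φ r`, so the infimum `t` is at most `2 |x - y|`.
  refine le_of_forall_gt_imp_ge_of_dense fun r hr => ?_
  have hr0 : 0 ≤ r := le_trans (by positivity) hr.le
  have hle : ε ≤ Φ ⟨r, hr0⟩ := hp.trans (hGF x ⟨_, hf.sum_mem s⟩ ⟨r, hr0⟩ hr)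
  have : sInf {t : ℝ≥0 | ε ≤ Φ t} ≤ ⟨r, hr0⟩ := csInf_le (OrderBot.bddBelow _) hle
  exact_mod_cast this

end Scheme

end

theorem theorem1 {K : ℕ} (hK : 0 < K) (S : Fin K → Set ℝ) (hS : ∀ k, IsClosed (S k))
    (f : (∀ k, S k) → ℝ) (φ : ∀ k, S k → ℝ) (D : Set ℝ) (F : D → ℝ) (Φ : ℝ≥0 → ℝ≥0)
    (hf : IsMonRepresentation f φ D F Φ) :
    ∃ (G : ℝ → ℝ) (hG : Measurable G), (∀ x : D, G x = F x) ∧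
      ∀ (M : ℕ), 0 < M → ∀ (P : ℝ), 0 < P →
      ∀ {Ω : Type*} [MeasurableSpace Ω] (μ : Measure Ω) [IsProbabilityMeasure μ]
        (R : SourceIdx K M → Ω → ℝ)
        (A : Matrix (FadingIdx K M) (SourceIdx K M) ℝ)
        (B : Matrix (NoiseIdx M) (SourceIdx K M) ℝ)
        (H : Fin K → Fin M → Ω → ℂ) (N : Fin M → Ω → ℂ),
        IsCorrelatedChannel μ R A B H N →
        (energyScheme M φ hf.inner_measurable G hG P (noiseEnergy N μ)).PeakPower P ∧
        ∀ Ai : Matrix (FadingIdx K M) (SourceIdx K M) ℝ,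
          UserUncorrelated (linImage Ai R) μ →
          ∀ (s : ∀ k, S k) (ε : ℝ), 0 < ε → (∃ t, ε ≤ Φ t) →
            (energyScheme M φ hf.inner_measurable G hG P (noiseEnergy N μ)).errorProb
                μ H N f s ε ≤
              2 * Real.exp (-(M * majorantInv Φ ε ^ 2 /
                (16 * constF φ P A B + constD φ P A Ai B
                  + 4 * majorantInv Φ ε * constL φ P A B))) +
              2 * Real.exp (-(M * majorantInv Φ ε ^ 2 /
                (256 * constF φ P A B + 32 * majorantInv Φ ε * constL φ P A B))) := by
  obtain ⟨G, hG, hGF, hGΦ⟩ := exists_measurable_extension hf.dom_measurable hf.outer_measurable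
    hf.strictMono.monotone hf.increment_le
  refine ⟨G, hG, hGF, fun M hM P hP Ω _ μ _ R A B H N h =>
    ⟨peakPower_energyScheme hf.inner_measurable hf.inner_bounded hG hP.le _,
      fun Ai _ s ε _ _ => ?_⟩⟩
  refine (errorProb_energyScheme_le h hf hG hGΦ hK hM hP s).trans ?_
  exact le_add_of_nonneg_left (by positivity)
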